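/- Let $M$ be a smooth $m$-dimensional manifold, let $g((X,\alpha),(Y,\beta))=\frac12(\alpha(Y)+\beta(X))$ be the neutral metric of $TM\oplus T^*M$, and let $$[(X,\alpha),(Y,\beta)]=\bigl([X,Y],\,L_X\beta-L_Y\alpha+\tfrac12 d(\alpha(Y)-\beta(X))\bigr)$$ be the Courant bracket. Let $\Phi$ be a generalized almost complex structure on $M$, i.e. a smooth vector bundle endomorphism of $TM\oplus T^*M$ with $\Phi^2=-\mathrm{Id}$ and $g(\mathcal X,\Phi\mathcal Y)+g(\Phi\mathcal X,\mathcal Y)=0$, and let $(A,\pi,\sigma)$ be its classical components, $A\in \mathrm{End}(TM)$, $\pi\in\chi^2(M)$, $\sigma\in\Omega^2(M)$, defined by $$\Phi(X,\alpha)=(AX+\sharp_\pi\alpha,\ \flat_\sigma X-\alpha\circ A),\qquad \sharp_\pi\alpha=\pi(\alpha,\cdot),\quad \flat_\sigma X=\sigma(X,\cdot).$$ Call $\Phi$ integrable if its Nijenhuis torsion $[\Phi\mathcal X,\Phi\mathcal Y]-\Phi[\mathcal X,\Phi\mathcal Y]-\Phi[\Phi\mathcal X,\mathcal Y]+\Phi^2[\mathcal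 X,\mathcal Y]$ (Courant brackets) vanishes for all smooth sections $\mathcal X,\mathcal Y$, and globally conformal integrable if there is $\tau\in C^\infty(M)$ such that $\mathcal C_{-\tau}\circ\Phi\circ\mathcal C_\tau$ is integrable, where $\mathcal C_\tau(X,\alpha)=(X,e^\tau\alpha)$. Then $\Phi$ is globally conformal integrable if and only if there exists $\tau\in C^\infty(M)$ such that $\varpi=d\tau$ satisfies, for all vector fields $X,Y,Z$ and all $1$-forms $\alpha$, $$[\pi,\pi]=-2(\sharp_\pi\varpi)\wedge\pi,$$ $$R_{(\pi,A)}(\alpha,X)=\varpi(X)\,A\sharp_\pi\alpha-\varpi(AX)\,\sharp_\pi\alpha,$$ $$\mathcal N_A(X,Y)-\sharp_\pi[i(X\wedge Y)d\sigma]=-\sigma(X,Y)\,\sharp_\pi\varpi+\varpi(X)(\mathrm{Id}+A^2)(Y)-\varpi(Y)(\mathrm{Id}+A^2)(X),$$ $$d\sigma_A(X,Y,Z)-\sum_{\mathrm{Cycl}(X,Y,Z)}d\sigma(AX,Y,Z)=-[\varpi\wedge\sigma_A+(\varpi\circ A)\wedge\sigma](X,Y,Z).$$ Here $[\pi,\pi]$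 is the Schouten-Nijenhuis bracket, with the sign convention $[X_1\wedge X_2,Q]=X_2\wedge L_{X_1}Q-X_1\wedge L_{X_2}Q$ for bivector fields $Q$; $R_{(\pi,A)}(\alpha,X)=\sharp_\pi(L_X(\alpha\circ A)-L_{AX}\alpha)-(L_{\sharp_\pi\alpha}A)(X)$ is the Schouten concomitant; $\mathcal N_A(X,Y)=[AX,AY]-A[X,AY]-A[AX,Y]+A^2[X,Y]$ is the Nijenhuis tensor of $A$; $i(X\wedge Y)d\sigma=d\sigma(X,Y,\cdot)$; and $\sigma_A(X,Y)=\sigma(AX,Y)$. -/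

import Mathlib

open Bundle VectorField
open scoped Manifold ContDiff

noncomputable section

namespace GenComplex

/-! ### Sections of `TM`, `T*M` and of the big tangent bundle `TM ⊕ T*M`

As for Mathlib's `VectorField.mlieBracket`, fields are plain dependent functions and their
smoothness is a separate predicate. -/

section Sections

variable {E : Type*} [NormedAddCommGroup E] [NormedSpace ℝ E]
  {M : Type*} [TopologicalSpace M] [ChartedSpace E M]

/-- The cotangent space `T*ₓM`. -/
abbrev Cotangent (E : Type*) [NormedAddCommGroup E] [NormedSpace ℝ E]
    {M : Type*} [TopologicalSpace M] [ChartedSpace E M] (x : M) : Type _ :=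
  TangentSpace 𝓘(ℝ, E) x →L[ℝ] ℝ

/-- The fibre `TₓM ⊕ T*ₓM` of the big tangent bundle, with its direct sum topology. -/
abbrev BigTangent (E : Type*) [NormedAddCommGroup E] [NormedSpace ℝ E]
    {M : Type*} [TopologicalSpace M] [ChartedSpace E M] (x : M) : Type _ :=
  ((TangentSpace 𝓘(ℝ, E) : M → Type _) ×ᵇ (Cotangent E : M → Type _)) x

variable (E M)

/-- Vector fields on `M`. -/
abbrev VField : Type _ := Π x : M, TangentSpace 𝓘(ℝ, E) x

/-- `1`-forms on `M`. -/
abbrev Form1 : Type _ := Π x : M, Cotangent E x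

/-- Covariant `2`-tensors on `M` (used for `2`-forms). -/
abbrev Form2 : Type _ :=
  Π x : M, TangentSpace 𝓘(ℝ, E) x →L[ℝ] TangentSpace 𝓘(ℝ, E) x →L[ℝ] ℝ

/-- Fields of endomorphisms of `TM`. -/
abbrev EndT : Type _ := Π x : M, TangentSpace 𝓘(ℝ, E) x →L[ℝ] TangentSpace 𝓘(ℝ, E) x

/-- Bivector fields `P`, represented by `♯_P : T*M → TM`, where `♯_P α = i(α) P`,
i.e. `P(α, β) = β (♯_P α)`. -/
abbrev Sharp : Type _ := Π x : M, Cotangent E x →L[ℝ] TangentSpace 𝓘(ℝ, E) x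

/-- Sections of the big tangent bundle. -/
abbrev BigField : Type _ := Π x : M, BigTangent E x

/-- Fields of endomorphisms of the big tangent bundle. -/
abbrev BigEnd : Type _ := Π x : M, BigTangent E x →L[ℝ] BigTangent E x

variable {E M} [IsManifold 𝓘(ℝ, E) ∞ M]

def SmoothVField (X : VField E M) : Prop :=
  ContMDiff 𝓘(ℝ, E) (𝓘(ℝ, E).prod 𝓘(ℝ, E)) ∞
    (fun x ↦ TotalSpace.mk' E (E := (TangentSpace 𝓘(ℝ, E) : M → Type _)) x (X x))

def SmoothForm1 (α : Form1 E M) : Prop :=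
  ContMDiff 𝓘(ℝ, E) (𝓘(ℝ, E).prod 𝓘(ℝ, E →L[ℝ] ℝ)) ∞
    (fun x ↦ TotalSpace.mk' (E →L[ℝ] ℝ) (E := (Cotangent E : M → Type _)) x (α x))

/-- Smooth sections of `End(TM ⊕ T*M)`. -/
def SmoothBigEnd (Φ : BigEnd E M) : Prop :=
  ContMDiff 𝓘(ℝ, E) (𝓘(ℝ, E).prod 𝓘(ℝ, (E × (E →L[ℝ] ℝ)) →L[ℝ] (E × (E →L[ℝ] ℝ)))) ∞
    (fun x ↦ TotalSpace.mk' ((E × (E →L[ℝ] ℝ)) →L[ℝ] (E × (E →L[ℝ] ℝ)))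
      (E := fun x : M ↦ BigTangent E x →L[ℝ] BigTangent E x) x (Φ x))

end Sections

/-! ### Differential calculus: Lie derivatives, exterior derivative, Schouten bracket -/

section Calculus

variable {E : Type*} [NormedAddCommGroup E] [NormedSpace ℝ E] [FiniteDimensional ℝ E]
  {M : Type*} [TopologicalSpace M] [ChartedSpace E M] [IsManifold 𝓘(ℝ, E) ∞ M]

/-- The differential `df`. -/
abbrev dFun (f : M → ℝ) : Form1 E M := fun x ↦ mvfderiv 𝓘(ℝ, E) f x

open Classical in
/-- The covector at `x` determined by an operation `F` on vector fields which is tensorial at `x`: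
it sends `Z x` to `F Z`. -/
def covectorAt (F : VField E M → ℝ) (x : M) : Cotangent E x :=
  if h : TensorialAt 𝓘(ℝ, E) E F x then TensorialAt.mkHom F x h else 0

/-- The Lie derivative of a `1`-form, `(L_X α)(Z) = X(α(Z)) - α([X, Z])`. -/
def lieDeriv1 (X : VField E M) (α : Form1 E M) : Form1 E M := fun x ↦
  covectorAt (fun Z ↦ dFun (fun y ↦ α y (Z y)) x (X x) - α x (mlieBracket 𝓘(ℝ, E) X Z x)) x

/-- Differentiability of a vector field at `x`. -/
abbrev DiffVFieldAt (Z : VField E M) (x : M) : Prop :=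
  MDifferentiableAt 𝓘(ℝ, E) (𝓘(ℝ, E).prod 𝓘(ℝ, E)) 
    (fun x ↦ TotalSpace.mk' E (E := (TangentSpace 𝓘(ℝ, E) : M → Type _)) x (Z x)) x

lemma covectorAt_apply {F : VField E M → ℝ} {x : M} (h : TensorialAt 𝓘(ℝ,E) E F x) {Z : VField E M}
   (hZ : DiffVFieldAt Z x) : covectorAt F x (Z x) = F Z := by
  rw [covectorAt, dif_pos h]
  exact TensorialAt.mkHom_apply h hZ

lemma differentiableAt_pairing (α : Form1 E M) {x : M} (hα : SmoothForm1 α) {Z : VField E M} (hZ : DiffVFieldAt Z x) : 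
   MDifferentiableAt 𝓘(ℝ, E) 𝓘(ℝ, ℝ) (fun y ↦ α y (Z y)) x := by
      have := MDifferentiableAt.clm_bundle_apply (b := fun y => y) (E₂ := Bundle.Trivial M ℝ) ((hα x).mdifferentiableAt (by simp)) hZ
      rw [mdifferentiableAt_totalSpace] at this
      exact this.2

lemma tensorialAt_lieDeriv1 (X : VField E M) (α : Form1 E M) (x : M) (hα : SmoothForm1 α) :
  TensorialAt 𝓘(ℝ,E) E (fun Z ↦ dFun (fun y ↦ α y (Z y)) x (X x) - α x (mlieBracket 𝓘(ℝ, E) X Z x)) x where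
  smul {f Z} hf hZ := by
    have h1 := differentiableAt_pairing α hα hZ
    rw [mlieBracket_smul_right hf hZ]
    have : (fun y => α y ((f • Z) y)) = f • (fun y ↦ α y (Z y)) := by ext y; simp
    simp only [dFun]
    rw [this]
    rw [mvfderiv_smul hf h1]
    simp
    ring
  add {σ σ'} hX hX' := by
    have h1 := differentiableAt_pairing α hα hX
    have h1' := differentiableAt_pairing α hα hX'
    rw [mlieBracket_add_right hX hX']
    have : (fun y => α y ((σ + σ') y)) = (fun y ↦ α y (σ y)) + (fun y ↦ α y (σ' y)) := by ext y; simp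
    simp only [dFun]
    rw [this]
    rw [mvfderiv_add h1 h1']
    simp
    ring

lemma lieDeriv1_apply (X : VField E M) (α : Form1 E M) (x : M) (hα : SmoothForm1 α) {Z : VField E M} (hZ : DiffVFieldAt Z x) :
  lieDeriv1 X α x (Z x) = dFun (fun y ↦ α y (Z y)) x (X x) - α x (mlieBracket 𝓘(ℝ, E) X Z x) :=
  covectorAt_apply (tensorialAt_lieDeriv1 X α x hα) hZ

/-- `(L_X A)(Y) = [X, AY] - A[X, Y]`. -/
def lieDerivEnd (X : VField E M) (A : EndT E M) (Y : VField E M) : VField E M := fun x ↦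
  mlieBracket 𝓘(ℝ, E) X (fun y ↦ A y (Y y)) x - A x (mlieBracket 𝓘(ℝ, E) X Y x)

/-- The exterior derivative of a `2`-form, `dw(X, Y, Z)`, by the invariant formula. -/
def extDeriv2 (w : Form2 E M) (X Y Z : VField E M) (x : M) : ℝ :=
  dFun (fun y ↦ w y (Y y) (Z y)) x (X x)
    + dFun (fun y ↦ w y (Z y) (X y)) x (Y x)
    + dFun (fun y ↦ w y (X y) (Y y)) x (Z x)
    - w x (mlieBracket 𝓘(ℝ, E) X Y x) (Z x)
    - w x (mlieBracket 𝓘(ℝ, E) Y Z x) (X x)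
    - w x (mlieBracket 𝓘(ℝ, E) Z X x) (Y x)

/-- The `1`-form `i(X ∧ Y) dw = dw(X, Y, ·)`. -/
def contractExtDeriv2 (w : Form2 E M) (X Y : VField E M) : Form1 E M := fun x ↦
  covectorAt (fun Z ↦ extDeriv2 w X Y Z x) x

/-- `{α, β}_P = L_{♯_P α} β - L_{♯_P β} α - d(P(α, β))`. -/
def formBracket (P : Sharp E M) (α β : Form1 E M) : Form1 E M := fun x ↦
  lieDeriv1 (fun y ↦ P y (α y)) β x - lieDeriv1 (fun y ↦ P y (β y)) α x
    - dFun (fun y ↦ β y (P y (α y))) x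

/-- The Schouten-Nijenhuis bracket `[P, Q]` of two bivector fields, evaluated on `1`-forms. The
sign is that of the convention `[X₁ ∧ X₂, Q] = X₂ ∧ L_{X₁} Q - X₁ ∧ L_{X₂} Q`
(see `schouten_wedge`), so that, with `{f, g} = P(df, dg)`,
`[P, P](df, dg, dh) = 2 ({{f, g}, h} + {{g, h}, f} + {{h, f}, g})`. -/
def schouten (P Q : Sharp E M) (α β γ : Form1 E M) (x : M) : ℝ :=
  γ x (P x (formBracket Q α β x) + Q x (formBracket P α β x)
    - mlieBracket 𝓘(ℝ, E) (fun y ↦ P y (α y)) (fun y ↦ Q y (β y)) x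
    - mlieBracket 𝓘(ℝ, E) (fun y ↦ Q y (α y)) (fun y ↦ P y (β y)) x)

/-- The Lie derivative of a bivector field,
`(L_X Q)(β, γ) = X(Q(β, γ)) - Q(L_X β, γ) - Q(β, L_X γ)`. -/
def lieDerivBivector (X : VField E M) (Q : Sharp E M) (β γ : Form1 E M) (x : M) : ℝ :=
  dFun (fun y => γ y (Q y (β y))) x (X x) - γ x (Q x (lieDeriv1 X β x)) - lieDeriv1 X γ x (Q x (β x)) 

/-- The derivation rule that fixes the Schouten-Nijenhuis bracket (which is additive in `P`):
for `P = X ∧ Y`, one has `[X ∧ Y, Q] = Y ∧ L_X Q - X ∧ L_Y Q`. -/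
lemma schouten_wedge (X Y : VField E M) (hX : SmoothVField X) (hY : SmoothVField Y)
   (P : Sharp E M) (wedge_apply : ∀ (x : M) (a : Cotangent E x), P x a = a (X x) • Y x - a (Y x) • X x) (Q : Sharp E M) (hQ : ∀ (x : M) (a b : Cotangent E x), b (Q x a) = - a (Q x b))
   (hQs : ∀ α, SmoothForm1 α → SmoothVField (fun x ↦ Q x (α x)))
   (α β γ : Form1 E M) (hα : SmoothForm1 α) (hβ : SmoothForm1 β) (hγ : SmoothForm1 γ) (x : M) :
   schouten P Q α β γ x = α x (Y x) * lieDerivBivector X Q β γ x + β x (Y x) * lieDerivBivector X Q γ α x + γ x (Y x) * lieDerivBivector X Q α β x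
    - (α x (X x) * lieDerivBivector Y Q β γ x + β x (X x) * lieDerivBivector Y Q γ α x + γ x (X x) * lieDerivBivector Y Q α β x) := by
  have hXx : DiffVFieldAt X x := (hX x).mdifferentiableAt (by simp)
  have hYx : DiffVFieldAt Y x := (hY x).mdifferentiableAt (by simp)
  have hQα : DiffVFieldAt (fun x ↦ Q x (α x)) x := (hQs α hα x).mdifferentiableAt (by simp)
  have hQβ : DiffVFieldAt (fun x ↦ Q x (β x)) x := (hQs β hβ x).mdifferentiableAt (by simp)
  have hQγ : DiffVFieldAt (fun x ↦ Q x (γ x)) x := (hQs γ hγ x).mdifferentiableAt (by simp)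
  have aX := differentiableAt_pairing α hα hXx
  have aY := differentiableAt_pairing α hα hYx
  have bX := differentiableAt_pairing β hβ hXx
  have bY := differentiableAt_pairing β hβ hYx
  have f1 (α : Form1 E M) : (fun y => P y (α y)) = (fun y => α y (X y)) • Y + (-((fun y => α y (Y y)) • X)) := by
    ext y; rw [wedge_apply]; simp; module
  have br (α : Form1 E M) (hα : SmoothForm1 α) (Z : VField E M) : 
     mlieBracket 𝓘(ℝ, E) (fun y => P y (α y)) Z x = 
      - dFun (fun y => α y (X y)) x (Z x) • Y x + α x (X x) • mlieBracket 𝓘(ℝ, E) Y Z x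
      + dFun (fun y => α y (Y y)) x (Z x) • X x - α x (Y x) • mlieBracket 𝓘(ℝ, E) X Z x := by
    have aX := differentiableAt_pairing α hα hXx
    have aY := differentiableAt_pairing α hα hYx
    have e : (-((fun y => α y (Y y)) • X)) = (-1:ℝ) • ((fun y => α y (Y y)) • X) := by simp
    have d1 : DiffVFieldAt ((fun y => α y (Y y)) • X) x := aY.smul_section hXx
    have d2 : DiffVFieldAt ((fun y => α y (X y)) • Y) x := aX.smul_section hYx
    have d3 : DiffVFieldAt ((-1 : ℝ) • ((fun y => α y (Y y)) • X)) x := (mdifferentiableAt_const (c := (-1:ℝ))).smul_section d1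
    rw [f1, e, mlieBracket_add_left d2 d3, mlieBracket_const_smul_left d1, mlieBracket_smul_left aX hYx, mlieBracket_smul_left aY hXx]
    simp
    module
  have dW (α : Form1 E M) (hα : SmoothForm1 α) : DiffVFieldAt (fun y => P y (α y)) x := by
    have aX := differentiableAt_pairing α hα hXx
    have aY := differentiableAt_pairing α hα hYx
    have e : (-((fun y => α y (Y y)) • X)) = (-1:ℝ) • ((fun y => α y (Y y)) • X) := by simp
    rw [f1, e]
    exact mdifferentiableAt_add_section (aX.smul_section hYx) ((mdifferentiableAt_const (c := (-1:ℝ))).smul_section (aY.smul_section hXx))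
  have sw (V W : VField E M) : mlieBracket 𝓘(ℝ, E) V W x = - mlieBracket 𝓘(ℝ, E) W V x := mlieBracket_swap_apply
  have pd (α β : Form1 E M) (hα : SmoothForm1 α) (hβ : SmoothForm1 β) : dFun (E := E) (fun y => β y (P y (α y))) x = 
      α x (X x) • dFun (E := E) (fun y => β y (Y y)) x + β x (Y x) • dFun (E := E) (fun y => α y (X y)) x
      - α x (Y x) • dFun (E := E) (fun y => β y (X y)) x - β x (X x) • dFun (E := E) (fun y => α y (Y y)) x := by
    have aX := differentiableAt_pairing α hα hXx
    have aY := differentiableAt_pairing α hα hYx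
    have bX := differentiableAt_pairing β hβ hXx
    have bY := differentiableAt_pairing β hβ hYx
    have key : (fun y => β y (P y (α y))) = (fun y => α y (X y)) • (fun y => β y (Y y)) + -((fun y => α y (Y y)) • (fun y => β y (X y))) := by
      ext y; simp [wedge_apply]; ring
    have m1 : MDifferentiableAt 𝓘(ℝ, E) 𝓘(ℝ, ℝ) ((fun y => α y (X y)) • (fun y => β y (Y y))) x := MDifferentiableAt.smul aX bY
    have m2 : MDifferentiableAt 𝓘(ℝ, E) 𝓘(ℝ, ℝ) (-((fun y => α y (Y y)) • (fun y => β y (X y)))) x := (MDifferentiableAt.smul aY bX).neg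
    simp only [dFun]
    rw [key, mvfderiv_add m1 m2, mvfderiv_neg, mvfderiv_smul (I := 𝓘(ℝ, E)) aX bY, mvfderiv_smul (I := 𝓘(ℝ, E)) aY bX]
    ext v
    simp
    ring
  -- evaluations
  simp only [schouten, map_add, map_sub]
  rw [hQ x (formBracket P α β x) (γ x), wedge_apply]
  simp only [formBracket, lieDerivBivector, sub_apply, map_sub, map_smul, smul_eq_mul]
  rw [hQ x (lieDeriv1 X β x) (γ x), hQ x (lieDeriv1 X γ x) (α x), hQ x (lieDeriv1 X α x) (β x), 
   hQ x (lieDeriv1 Y β x) (γ x), hQ x (lieDeriv1 Y γ x) (α x), hQ x (lieDeriv1 Y α x) (β x)]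
  have L (V : VField E M) (α γ : Form1 E M) (hα : SmoothForm1 α) (hγ : SmoothForm1 γ) : 
    lieDeriv1 V α x (Q x (γ x)) = _ := lieDeriv1_apply V α x hα (Z := fun x => Q x (γ x)) ((hQs γ hγ x).mdifferentiableAt (by simp))
  have LX (V : VField E M) (α : Form1 E M) (hα : SmoothForm1 α) : 
    lieDeriv1 V α x (X x) = _ := lieDeriv1_apply V α x hα hXx
  have LY (V : VField E M) (α : Form1 E M) (hα : SmoothForm1 α) : 
    lieDeriv1 V α x (Y x) = _ := lieDeriv1_apply V α x hα hYx
  simp only [LX _ _ hα, LX _ _ hβ, LY _ _ hα, LY _ _ hβ, L _ _ _ hα hβ, L _ _ _ hα hγ, L _ _ _ hβ hα, L _ _ _ hβ hγ, L _ _ _ hγ hα, L _ _ _ hγ hβ, br α hα, br β hβ, pd α β hα hβ]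
  rw [sw (fun y ↦ Q y (α y)) (fun y => P y (β y)), br β hβ]
  have sQ (α β : Form1 E M) : (fun y => α y (Q y (β y))) = -(fun y => β y (Q y (α y))) := by
    ext y; simp [hQ y (β y) (α y)]
  rw [sQ α β, sQ γ α, sQ β γ, sw _ X, sw _ X, sw _ Y, sw _ Y]
  simp only [dFun, mvfderiv_neg]
  simp [wedge_apply]
  ring

/-- `(V ∧ P)(a, b, c)` for a vector `V` and a bivector `P` at `x`. -/
def wedgeVecBivector {x : M} (V : TangentSpace 𝓘(ℝ, E) x)
    (P : Cotangent E x →L[ℝ] TangentSpace 𝓘(ℝ, E) x) (a b c : Cotangent E x) : ℝ :=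
  a V * c (P b) + b V * a (P c) + c V * b (P a)

/-- `(l ∧ w)(u, v, z)` for a covector `l` and a `2`-covector `w` at `x`. -/
def wedgeForm12 {x : M} (l : Cotangent E x)
    (w : TangentSpace 𝓘(ℝ, E) x →L[ℝ] TangentSpace 𝓘(ℝ, E) x →L[ℝ] ℝ)
    (u v z : TangentSpace 𝓘(ℝ, E) x) : ℝ :=
  l u * w v z + l v * w z u + l z * w u v

/-- The Nijenhuis tensor of a field of endomorphisms of `TM`. -/
def nijenhuis (A : EndT E M) (X Y : VField E M) : VField E M := fun x ↦
  mlieBracket 𝓘(ℝ, E) (fun y ↦ A y (X y)) (fun y ↦ A y (Y y)) x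
    - A x (mlieBracket 𝓘(ℝ, E) X (fun y ↦ A y (Y y)) x)
    - A x (mlieBracket 𝓘(ℝ, E) (fun y ↦ A y (X y)) Y x)
    + A x (A x (mlieBracket 𝓘(ℝ, E) X Y x))

/-- The Schouten concomitant
`R_{(P, A)}(α, X) = ♯_P (L_X (α ∘ A) - L_{AX} α) - (L_{♯_P α} A)(X)`. -/
def concomitant (P : Sharp E M) (A : EndT E M) (α : Form1 E M) (X : VField E M) : VField E M :=
  fun x ↦
    P x (lieDeriv1 X (fun y ↦ (α y).comp (A y)) x - lieDeriv1 (fun y ↦ A y (X y)) α x)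
      - lieDerivEnd (fun y ↦ P y (α y)) A X x

end Calculus

/-! ### Generalized almost complex structures -/

section Structures

variable {E : Type*} [NormedAddCommGroup E] [NormedSpace ℝ E] [FiniteDimensional ℝ E]
  {M : Type*} [TopologicalSpace M] [ChartedSpace E M] [IsManifold 𝓘(ℝ, E) ∞ M]

/-- The neutral metric `g((X, α), (Y, β)) = (α(Y) + β(X)) / 2`. -/
def neutralMetric {x : M} (u v : BigTangent E x) : ℝ := (1 / 2) * (u.2 v.1 + v.2 u.1)

/-- The Courant bracket
`[(X, α), (Y, β)] = ([X, Y], L_X β - L_Y α + (1/2) d(α(Y) - β(X)))`. -/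
def courantBracket (u v : BigField E M) : BigField E M := fun x ↦
  (mlieBracket 𝓘(ℝ, E) (fun y ↦ (u y).1) (fun y ↦ (v y).1) x,
    lieDeriv1 (fun y ↦ (u y).1) (fun y ↦ (v y).2) x
      - lieDeriv1 (fun y ↦ (v y).1) (fun y ↦ (u y).2) x
      + (1 / 2 : ℝ) • dFun (fun y ↦ (u y).2 (v y).1 - (v y).2 (u y).1) x)

/-- The Nijenhuis torsion, with respect to the Courant bracket, of an endomorphism of `TM ⊕ T*M`. -/
def courantTorsion (Φ : BigEnd E M) (u v : BigField E M) : BigField E M := fun x ↦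
  courantBracket (fun y ↦ Φ y (u y)) (fun y ↦ Φ y (v y)) x
    - Φ x (courantBracket u (fun y ↦ Φ y (v y)) x)
    - Φ x (courantBracket (fun y ↦ Φ y (u y)) v x)
    + Φ x (Φ x (courantBracket u v x))

/-- Integrability: the Nijenhuis torsion vanishes on all smooth sections of `TM ⊕ T*M`. -/
def IsIntegrable (Φ : BigEnd E M) : Prop :=
  ∀ u v : BigField E M,
    SmoothVField (fun x ↦ (u x).1) → SmoothForm1 (fun x ↦ (u x).2) →
    SmoothVField (fun x ↦ (v x).1) → SmoothForm1 (fun x ↦ (v x).2) →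
    ∀ x, courantTorsion Φ u v x = 0

variable (E M) in
/-- A generalized almost complex structure on `M`. -/
structure GenAlmostComplexStructure where
  /-- the underlying vector bundle endomorphism of `TM ⊕ T*M` -/
  toEnd : BigEnd E M
  smooth : SmoothBigEnd toEnd
  sq : ∀ (x : M) (u : BigTangent E x), toEnd x (toEnd x u) = -u
  skew : ∀ (x : M) (u v : BigTangent E x),
    neutralMetric u (toEnd x v) + neutralMetric (toEnd x u) v = 0

/-- The conformal change `C_τ (X, α) = (X, e^τ α)`. -/
def conformalAut (τ : M → ℝ) : BigEnd E M := fun x ↦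
  (ContinuousLinearMap.id ℝ (TangentSpace 𝓘(ℝ, E) x)).prodMap
    (Real.exp (τ x) • ContinuousLinearMap.id ℝ (Cotangent E x))

/-- `Φ' = C_{-τ} ∘ Φ ∘ C_τ`. -/
def conformalChange (τ : M → ℝ) (Φ : BigEnd E M) : BigEnd E M := fun x ↦
  (conformalAut (-τ) x).comp ((Φ x).comp (conformalAut τ x))

namespace GenAlmostComplexStructure

variable (Φ : GenAlmostComplexStructure E M)

/-- Globally conformal integrable structures. -/
def GloballyConformalIntegrable : Prop :=
  ∃ τ : M → ℝ, ContMDiff 𝓘(ℝ, E) 𝓘(ℝ, ℝ) ∞ τ ∧ IsIntegrable (conformalChange τ Φ.toEnd)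

/-- The classical component `A`: the `TM`-part of `Φ(X, 0)` is `A X`. -/
def A : EndT E M := fun x ↦
  (ContinuousLinearMap.fst ℝ (TangentSpace 𝓘(ℝ, E) x) (Cotangent E x)).comp
    ((Φ.toEnd x).comp (ContinuousLinearMap.inl ℝ (TangentSpace 𝓘(ℝ, E) x) (Cotangent E x)))

/-- The classical component `π`, through `♯_π`: the `TM`-part of `Φ(0, α)` is `♯_π α`. -/
def pi : Sharp E M := fun x ↦
  (ContinuousLinearMap.fst ℝ (TangentSpace 𝓘(ℝ, E) x) (Cotangent E x)).comp
    ((Φ.toEnd x).comp (ContinuousLinearMap.inr ℝ (TangentSpace 𝓘(ℝ, E) x) (Cotangent E x)))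

/-- The classical component `σ`: the `T*M`-part of `Φ(X, 0)` is `♭_σ X = i(X) σ`. -/
def sigma : Form2 E M := fun x ↦
  (ContinuousLinearMap.snd ℝ (TangentSpace 𝓘(ℝ, E) x) (Cotangent E x)).comp
    ((Φ.toEnd x).comp (ContinuousLinearMap.inl ℝ (TangentSpace 𝓘(ℝ, E) x) (Cotangent E x)))

/-- The associated `2`-form `σ_A(X, Y) = σ(AX, Y)`. -/
def sigmaA : Form2 E M := fun x ↦ (Φ.sigma x).comp (Φ.A x)

end GenAlmostComplexStructure

end Structures

end GenComplex

end
open GenComplex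

open Bundle VectorField
open scoped Manifold ContDiff

noncomputable section
set_option linter.unusedSectionVars false

namespace GenComplex

/-! ### Smooth sections -/

section Extension

variable {E : Type*} [NormedAddCommGroup E] [NormedSpace ℝ E] [FiniteDimensional ℝ E]
  {M : Type*} [TopologicalSpace M] [ChartedSpace E M] [IsManifold 𝓘(ℝ, E) ∞ M] [T2Space M]

/-! The conformal change by `τ` keeps `A` and replaces `(π, σ)` by `(e^τ π, e^{-τ} σ)`
(`conformalChange_hasComponents`). Thus everything reduces to the classical integrability criterion
for these rescaled components, followed by four Leibniz computations in which an exponential factors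
out and leaves the terms in `dτ`.

The criterion (`isIntegrable_iff`) comes from pairing the Courant torsion with a third section. The
pairing `2g([u, v], w)` is a cyclic expression plus derivatives of pairings
(`bigPairing_courantBracket`), and in the torsion these derivatives cancel because the structure is
`g`-skew with square `-Id` (`bigPairing_torsion`). The resulting form is additive and cyclic, so it
suffices to test it on triples of pure vector fields and pure 1-forms, of which only four types
remain up to rotation (`torsionForm_eq_zero`). Those types are the four classical equations, and
nondegeneracy of `g` recovers the whole torsion.

The rescaling is done in `schouten_smul`, `concomitant_smul`, `contractExtDeriv2_smul` and
`extDeriv2_smul`, and assembled in `isIntegrable_conformalChange_iff`. -/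

/-- Every element of a fibre of a smooth vector bundle is the value of a global smooth section. -/
lemma exists_contMDiff_section_apply_eq (F : Type*) [NormedAddCommGroup F] [NormedSpace ℝ F]
    {V : M → Type*} [TopologicalSpace (TotalSpace F V)] [∀ x, AddCommGroup (V x)]
    [∀ x, Module ℝ (V x)] [∀ x, TopologicalSpace (V x)] [FiberBundle F V] [VectorBundle ℝ F V]
    [ContMDiffVectorBundle ∞ F V 𝓘(ℝ, E)] {x : M} (v : V x) :
    ∃ σ : Π y, V y, ContMDiff 𝓘(ℝ, E) (𝓘(ℝ, E).prod 𝓘(ℝ, F)) ∞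
      (fun y ↦ TotalSpace.mk' F y (σ y)) ∧ σ x = v := by
  obtain ⟨s, hs, hsv⟩ := FiberBundle.exists_contMDiffOn_extend (k := ∞) 𝓘(ℝ, E) F v
  obtain ⟨u, hus, hu, hxu⟩ := mem_nhds_iff.1 hs
  obtain ⟨f, -, hf⟩ := (SmoothBumpFunction.nhds_basis_tsupport (I := 𝓘(ℝ, E)) x).mem_iff.1
    (hu.mem_nhds hxu)
  -- The bump function is 1 at `x`, and its closed support lies in the open set on which the local
  -- extension is smooth.
  refine ⟨(f : M → ℝ) • FiberBundle.extend F v, ?_, ?_⟩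
  · exact ContMDiffOn.smul_section_of_tsupport f.contMDiff.contMDiffOn hu hf
      (hsv.mono hus)
  · simp

lemma exists_smoothVField_apply_eq {x : M} (v : TangentSpace 𝓘(ℝ, E) x) :
    ∃ X : VField E M, SmoothVField X ∧ X x = v :=
  exists_contMDiff_section_apply_eq E v

lemma exists_smoothForm1_apply_eq {x : M} (a : Cotangent E x) :
    ∃ α : Form1 E M, SmoothForm1 α ∧ α x = a :=
  exists_contMDiff_section_apply_eq (V := (Cotangent E : M → Type _)) (E →L[ℝ] ℝ) a

end Extension

/-! ### Smoothness of sections of the big tangent bundle and its closure properties. -/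

section Smooth

variable {E : Type*} [NormedAddCommGroup E] [NormedSpace ℝ E]
  {M : Type*} [TopologicalSpace M] [ChartedSpace E M] [IsManifold 𝓘(ℝ, E) ∞ M]

/-- Smooth sections of the big tangent bundle. -/
def SmoothBigField (u : BigField E M) : Prop :=
  SmoothVField (fun x ↦ (u x).1) ∧ SmoothForm1 (fun x ↦ (u x).2)

/-- Trivialisations of a direct sum act componentwise. This links the componentwise notion to the
bundle one, on which smooth endomorphisms act. -/
lemma smoothBigField_iff (u : BigField E M) : SmoothBigField u ↔
    ContMDiff 𝓘(ℝ, E) (𝓘(ℝ, E).prod 𝓘(ℝ, E × (E →L[ℝ] ℝ))) ∞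
      (fun x ↦ TotalSpace.mk' (E × (E →L[ℝ] ℝ)) (E := fun x : M ↦ BigTangent E x) x (u x)) := by
  simp only [SmoothBigField, SmoothVField, SmoothForm1, ContMDiff, ← forall_and]
  refine forall_congr' fun x ↦ ?_
  rw [contMDiffAt_section, contMDiffAt_section, contMDiffAt_section]
  exact ⟨fun h ↦ h.1.prodMk_space h.2, fun h ↦
    ⟨(contDiff_fst (𝕜 := ℝ) (E := E) (F := E →L[ℝ] ℝ)).contDiffAt.contMDiffAt.comp x h,
      (contDiff_snd (𝕜 := ℝ) (E := E) (F := E →L[ℝ] ℝ)).contDiffAt.contMDiffAt.comp x h⟩⟩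

lemma SmoothBigEnd.apply {Φ : BigEnd E M} (hΦ : SmoothBigEnd Φ) {u : BigField E M}
    (hu : SmoothBigField u) : SmoothBigField (fun x ↦ Φ x (u x)) := by
  rw [smoothBigField_iff] at hu ⊢
  exact ContMDiff.clm_bundle_apply (b := fun y : M ↦ y) hΦ hu

lemma smoothVField_zero : SmoothVField (0 : VField E M) :=
  contMDiff_zeroSection ℝ (TangentSpace 𝓘(ℝ, E) : M → Type _)

lemma smoothForm1_zero : SmoothForm1 (0 : Form1 E M) :=
  contMDiff_zeroSection ℝ (Cotangent E : M → Type _)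

lemma SmoothVField.add {X Y : VField E M} (hX : SmoothVField X) (hY : SmoothVField Y) :
    SmoothVField (X + Y) :=
  ContMDiff.add_section hX hY

lemma SmoothForm1.add {α β : Form1 E M} (hα : SmoothForm1 α) (hβ : SmoothForm1 β) :
    SmoothForm1 (α + β) :=
  ContMDiff.add_section (V := (Cotangent E : M → Type _)) hα hβ

lemma SmoothForm1.neg {α : Form1 E M} (hα : SmoothForm1 α) : SmoothForm1 (-α) :=
  ContMDiff.neg_section (V := (Cotangent E : M → Type _)) hα

lemma SmoothForm1.sub {α β : Form1 E M} (hα : SmoothForm1 α) (hβ : SmoothForm1 β) :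
    SmoothForm1 (α - β) :=
  ContMDiff.sub_section (V := (Cotangent E : M → Type _)) hα hβ

lemma SmoothVField.smul {f : M → ℝ} (hf : ContMDiff 𝓘(ℝ, E) 𝓘(ℝ, ℝ) ∞ f) {X : VField E M}
    (hX : SmoothVField X) : SmoothVField (f • X) :=
  ContMDiff.smul_section hf hX

lemma SmoothForm1.smul {f : M → ℝ} (hf : ContMDiff 𝓘(ℝ, E) 𝓘(ℝ, ℝ) ∞ f) {α : Form1 E M}
    (hα : SmoothForm1 α) : SmoothForm1 (f • α) :=
  ContMDiff.smul_section (V := (Cotangent E : M → Type _)) hf hα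

lemma SmoothVField.diffVFieldAt {X : VField E M} (hX : SmoothVField X) (x : M) :
    MDifferentiableAt 𝓘(ℝ, E) (𝓘(ℝ, E).prod 𝓘(ℝ, E))
      (fun x ↦ TotalSpace.mk' E (E := (TangentSpace 𝓘(ℝ, E) : M → Type _)) x (X x)) x :=
  (hX x).mdifferentiableAt (by simp)

end Smooth

/-! ### Components of endomorphisms of the big tangent bundle -/

section Components

variable {E : Type*} [NormedAddCommGroup E] [NormedSpace ℝ E]
  {M : Type*} [TopologicalSpace M] [ChartedSpace E M] [IsManifold 𝓘(ℝ, E) ∞ M]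

/-- `Ψ` is a generalized almost complex structure with classical components `A`, `P`, `s`. -/
structure HasComponents (Ψ : BigEnd E M) (A : EndT E M) (P : Sharp E M) (s : Form2 E M) :
    Prop where
  apply : ∀ x (u : BigTangent E x), Ψ x u = (A x u.1 + P x u.2, s x u.1 - u.2.comp (A x))
  smooth_A : ∀ X, SmoothVField X → SmoothVField (fun x ↦ A x (X x))
  smooth_P : ∀ α, SmoothForm1 α → SmoothVField (fun x ↦ P x (α x))
  smooth_s : ∀ X, SmoothVField X → SmoothForm1 (fun x ↦ s x (X x))
  smooth_comp : ∀ α, SmoothForm1 α → SmoothForm1 (fun x ↦ (α x).comp (A x))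
  P_skew : ∀ x (a b : Cotangent E x), b (P x a) = -a (P x b)
  s_skew : ∀ x (v w : TangentSpace 𝓘(ℝ, E) x), s x v w = -s x w v
  A_A : ∀ x (v : TangentSpace 𝓘(ℝ, E) x), A x (A x v) = -v - P x (s x v)
  A_P : ∀ x (a : Cotangent E x), A x (P x a) = P x (a.comp (A x))
  s_A : ∀ x (v w : TangentSpace 𝓘(ℝ, E) x), s x (A x v) w = s x v (A x w)

/-- The components are read off on pure vectors and pure covectors: skewness gives the skew-symmetry
of `π` and `σ`, and `Φ² = -Id` gives the relations with `A`. -/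
lemma GenAlmostComplexStructure.hasComponents (Φ : GenAlmostComplexStructure E M) :
    HasComponents Φ.toEnd Φ.A Φ.pi Φ.sigma := by
  have h1 (x : M) (v : TangentSpace 𝓘(ℝ, E) x) : Φ.toEnd x (v, 0) = (Φ.A x v, Φ.sigma x v) := rfl
  have h2 (x : M) (a : Cotangent E x) : Φ.toEnd x (0, a) = (Φ.pi x a, -(a.comp (Φ.A x))) := by
    refine Prod.ext rfl ?_
    ext v
    -- Pairing a covector with a vector forces the form part of `Φ(0, a)` to be minus the transpose
    -- of `A`.
    have := Φ.skew x (0, a) (v, 0)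
    rw [h1] at this
    simp only [neutralMetric] at this
    simp at this ⊢
    linarith
  have h (x : M) (u : BigTangent E x) :
      Φ.toEnd x u = (Φ.A x u.1 + Φ.pi x u.2, Φ.sigma x u.1 - u.2.comp (Φ.A x)) := by
    have : u = ((u.1, 0) : BigTangent E x) + ((0, u.2) : BigTangent E x) :=
      Prod.ext (add_zero _).symm (zero_add _).symm
    rw [this, (Φ.toEnd x).map_add, h1, h2]
    simp [sub_eq_add_neg]
  have sv (X : VField E M) (hX : SmoothVField X) :
      SmoothBigField (fun x ↦ (Φ.toEnd x (X x, 0) : BigTangent E x)) :=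
    Φ.smooth.apply (u := fun x ↦ (X x, 0)) ⟨hX, smoothForm1_zero⟩
  have sf (α : Form1 E M) (hα : SmoothForm1 α) :
      SmoothBigField (fun x ↦ (Φ.toEnd x (0, α x) : BigTangent E x)) :=
    Φ.smooth.apply (u := fun x ↦ (0, α x)) ⟨smoothVField_zero, hα⟩
  have q1 (x : M) (v : TangentSpace 𝓘(ℝ, E) x) := Φ.sq x (v, 0)
  have q2 (x : M) (a : Cotangent E x) := Φ.sq x (0, a)
  simp only [h1, h2, h, Prod.ext_iff] at q1 q2
  refine ⟨h, fun X hX ↦ (sv X hX).1, fun α hα ↦ (sf α hα).1, fun X hX ↦ (sv X hX).2, ?_, ?_, ?_,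
    ?_, ?_, ?_⟩
  · intro α hα
    have := (sf α hα).2.neg
    simp only [h2] at this
    convert this using 1
    ext x v
    simp
  · intro x a b
    have := Φ.skew x (0, a) (0, b)
    simp only [h2, neutralMetric] at this
    simp at this
    linarith
  · intro x v w
    have := Φ.skew x (v, 0) (w, 0)
    simp only [h1, neutralMetric] at this
    simp at this
    linarith
  · intro x v
    have := (q1 x v).1
    exact eq_sub_of_add_eq this
  · intro x a
    have := (q2 x a).1
    simp at this
    exact add_neg_eq_zero.1 this
  · intro x v w
    have := congrArg (fun l : Cotangent E x ↦ l w) (q1 x v).2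
    simp at this
    linarith

/-- A covector input contributes `e^τ` and a covector output `e^{-τ}`; the transpose of `A` and the
composite `♯_π ♭_σ` receive both, which cancel. -/
lemma conformalChange_hasComponents {Ψ : BigEnd E M} {A : EndT E M} {P : Sharp E M}
    {s : Form2 E M} (h : HasComponents Ψ A P s) {τ : M → ℝ}
    (hτ : ContMDiff 𝓘(ℝ, E) 𝓘(ℝ, ℝ) ∞ τ) :
    HasComponents (conformalChange τ Ψ) A (fun x ↦ Real.exp (τ x) • P x)
      (fun x ↦ Real.exp (-τ x) • s x) := by
  have e1 : ContMDiff 𝓘(ℝ, E) 𝓘(ℝ, ℝ) ∞ (fun x ↦ Real.exp (τ x)) :=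
    Real.contDiff_exp.comp_contMDiff hτ
  have e2 : ContMDiff 𝓘(ℝ, E) 𝓘(ℝ, ℝ) ∞ (fun x ↦ Real.exp (-τ x)) :=
    Real.contDiff_exp.comp_contMDiff hτ.neg
  have ee (x : M) : Real.exp (-τ x) * Real.exp (τ x) = 1 := by rw [← Real.exp_add]; simp
  refine ⟨?_, h.smooth_A, fun α hα ↦ (h.smooth_P α hα).smul e1,
    fun X hX ↦ (h.smooth_s X hX).smul e2, h.smooth_comp, ?_, ?_, ?_, ?_, ?_⟩
  · intro x u
    simp only [conformalChange, conformalAut, ContinuousLinearMap.comp_apply, h.apply]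
    refine Prod.ext (by simp) ?_
    ext v
    simp
    linear_combination (-(u.2 (A x v))) * ee x
  · intro x a b
    simp [h.P_skew x a b]
  · intro x v w
    simp [h.s_skew x v w]
  · intro x v
    simp [h.A_A x v, smul_smul, ee]
  · intro x a
    simp [h.A_P]
  · intro x v w
    simp [h.s_A]

end Components

/-! ### The Courant bracket and its torsion, paired with a third section -/

section Pairing

variable {E : Type*} [NormedAddCommGroup E] [NormedSpace ℝ E] [FiniteDimensional ℝ E]
  {M : Type*} [TopologicalSpace M] [ChartedSpace E M] [IsManifold 𝓘(ℝ, E) ∞ M]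

lemma dFun_add_apply {f g : M → ℝ} {x : M} (hf : MDifferentiableAt 𝓘(ℝ, E) 𝓘(ℝ, ℝ) f x)
    (hg : MDifferentiableAt 𝓘(ℝ, E) 𝓘(ℝ, ℝ) g x) (v : TangentSpace 𝓘(ℝ, E) x) :
    dFun (fun y ↦ f y + g y) x v = dFun f x v + dFun g x v :=
  congrArg (fun l : Cotangent E x ↦ l v) (mvfderiv_add hf hg)

lemma dFun_sub_apply {f g : M → ℝ} {x : M} (hf : MDifferentiableAt 𝓘(ℝ, E) 𝓘(ℝ, ℝ) f x)
    (hg : MDifferentiableAt 𝓘(ℝ, E) 𝓘(ℝ, ℝ) g x) (v : TangentSpace 𝓘(ℝ, E) x) :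
    dFun (fun y ↦ f y - g y) x v = dFun f x v - dFun g x v :=
  congrArg (fun l : Cotangent E x ↦ l v) (mvfderiv_sub hf hg)

lemma dFun_neg_apply (f : M → ℝ) (x : M) (v : TangentSpace 𝓘(ℝ, E) x) :
    dFun (fun y ↦ -f y) x v = -dFun f x v :=
  congrArg (fun l : Cotangent E x ↦ l v) (mvfderiv_neg (g := f))

lemma dFun_mul_apply {f g : M → ℝ} {x : M} (hf : MDifferentiableAt 𝓘(ℝ, E) 𝓘(ℝ, ℝ) f x)
    (hg : MDifferentiableAt 𝓘(ℝ, E) 𝓘(ℝ, ℝ) g x) (v : TangentSpace 𝓘(ℝ, E) x) :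
    dFun (fun y ↦ f y * g y) x v = f x * dFun g x v + g x * dFun f x v := by
  have := congrArg (fun l : Cotangent E x ↦ l v) (mvfderiv_mul hf hg)
  exact this

/-- The `1`-form-vector pairing is differentiable. -/
lemma mdifferentiableAt_pairing {α : Form1 E M} {X : VField E M} (hα : SmoothForm1 α)
    (hX : SmoothVField X) (x : M) :
    MDifferentiableAt 𝓘(ℝ, E) 𝓘(ℝ, ℝ) (fun y ↦ α y (X y)) x :=
  differentiableAt_pairing α hα (hX.diffVFieldAt x)

/-- Twice the neutral metric. -/
def bigPairing {x : M} (u v : BigTangent E x) : ℝ := u.2 v.1 + v.2 u.1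

/-- The totally skew-symmetric part of `(u, v, w) ↦ 2 g([u, v], w)`. -/
def skewBracket (u v w : BigField E M) (x : M) : ℝ :=
  (w x).2 (mlieBracket 𝓘(ℝ, E) (fun y ↦ (u y).1) (fun y ↦ (v y).1) x)
    + (u x).2 (mlieBracket 𝓘(ℝ, E) (fun y ↦ (v y).1) (fun y ↦ (w y).1) x)
    + (v x).2 (mlieBracket 𝓘(ℝ, E) (fun y ↦ (w y).1) (fun y ↦ (u y).1) x)
    + (1 / 2) * (dFun (fun y ↦ (v y).2 (w y).1 - (w y).2 (v y).1) x (u x).1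
      + dFun (fun y ↦ (w y).2 (u y).1 - (u y).2 (w y).1) x (v x).1
      + dFun (fun y ↦ (u y).2 (v y).1 - (v y).2 (u y).1) x (w x).1)

lemma skewBracket_cycl (u v w : BigField E M) (x : M) :
    skewBracket u v w x = skewBracket v w u x := by
  simp only [skewBracket]
  ring

lemma SmoothBigField.add {u v : BigField E M} (hu : SmoothBigField u) (hv : SmoothBigField v) :
    SmoothBigField (fun x ↦ u x + v x) :=
  ⟨hu.1.add hv.1, hu.2.add hv.2⟩

lemma skewBracket_add {u u' v w : BigField E M} (hu : SmoothBigField u) (hu' : SmoothBigField u')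
    (hv : SmoothBigField v) (hw : SmoothBigField w) (x : M) :
    skewBracket (fun y ↦ u y + u' y) v w x = skewBracket u v w x + skewBracket u' v w x := by
  have p (a b : BigField E M) (ha : SmoothBigField a) (hb : SmoothBigField b) :=
    mdifferentiableAt_pairing ha.2 hb.1 x
  have s (a b : BigField E M) (ha : SmoothBigField a) (hb : SmoothBigField b) :
    MDifferentiableAt 𝓘(ℝ, E) 𝓘(ℝ, ℝ) (fun y ↦ (a y).2 (b y).1 - (b y).2 (a y).1) x :=
    (p a b ha hb).sub (p b a hb ha)
  have e1 : (fun y ↦ (w y).2 (u y + u' y).1 - (u y + u' y).2 (w y).1) = fun y ↦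
      ((w y).2 (u y).1 - (u y).2 (w y).1) + ((w y).2 (u' y).1 - (u' y).2 (w y).1) := by
    ext y; simp; ring
  have e2 : (fun y ↦ (u y + u' y).2 (v y).1 - (v y).2 (u y + u' y).1) = fun y ↦
      ((u y).2 (v y).1 - (v y).2 (u y).1) + ((u' y).2 (v y).1 - (v y).2 (u' y).1) := by
    ext y; simp; ring
  have b1 : (mlieBracket 𝓘(ℝ, E) (fun y ↦ (u y + u' y).1) (fun y ↦ (v y).1) x) =
      mlieBracket 𝓘(ℝ, E) (fun y ↦ (u y).1) (fun y ↦ (v y).1) x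
        + mlieBracket 𝓘(ℝ, E) (fun y ↦ (u' y).1) (fun y ↦ (v y).1) x :=
    mlieBracket_add_left (hu.1.diffVFieldAt x) (hu'.1.diffVFieldAt x)
  have b2 : (mlieBracket 𝓘(ℝ, E) (fun y ↦ (w y).1) (fun y ↦ (u y + u' y).1) x) =
      mlieBracket 𝓘(ℝ, E) (fun y ↦ (w y).1) (fun y ↦ (u y).1) x
        + mlieBracket 𝓘(ℝ, E) (fun y ↦ (w y).1) (fun y ↦ (u' y).1) x :=
    mlieBracket_add_right (hu.1.diffVFieldAt x) (hu'.1.diffVFieldAt x)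
  simp only [skewBracket]
  rw [e1, e2, b1, b2, dFun_add_apply (s w u hw hu) (s w u' hw hu'),
    dFun_add_apply (s u v hu hv) (s u' v hu' hv)]
  simp only [Prod.fst_add, Prod.snd_add, map_add, add_apply]
  ring

/-- The only obstruction to cyclicity of `2g([u, v], w)` consists of derivatives of the functions
`2g(v, w)` and `2g(u, w)`. -/
lemma bigPairing_courantBracket {u v w : BigField E M} (hu : SmoothBigField u)
    (hv : SmoothBigField v) (hw : SmoothBigField w) (x : M) :
    bigPairing (courantBracket u v x) (w x) = skewBracket u v w x
      + (1 / 2) * (dFun (fun y ↦ bigPairing (v y) (w y)) x (u x).1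
        - dFun (fun y ↦ bigPairing (u y) (w y)) x (v x).1) := by
  have p (a b : BigField E M) (ha : SmoothBigField a) (hb : SmoothBigField b) :=
    mdifferentiableAt_pairing ha.2 hb.1 x
  have l (X : VField E M) (a b : BigField E M) (ha : SmoothBigField a) (hb : SmoothBigField b) :
      lieDeriv1 X (fun y ↦ (a y).2) x (b x).1 = _ :=
    lieDeriv1_apply X (fun y ↦ (a y).2) x ha.2 (Z := fun y ↦ (b y).1) (hb.1.diffVFieldAt x)
  simp only [bigPairing, skewBracket, courantBracket]
  rw [dFun_add_apply (p v w hv hw) (p w v hw hv), dFun_add_apply (p u w hu hw) (p w u hw hu),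
    dFun_sub_apply (p v w hv hw) (p w v hw hv), dFun_sub_apply (p w u hw hu) (p u w hu hw)]
  simp only [add_apply, sub_apply, smul_apply, l _ _ _ hv hw, l _ _ _ hu hw]
  rw [mlieBracket_swap_apply (V := fun y ↦ (w y).1) (W := fun y ↦ (u y).1)]
  simp only [map_neg, smul_eq_mul]
  ring

/-- The totally skew-symmetric form `(u, v, w) ↦ 2 g(N(u, v), w)` attached to the torsion `N` of `Ψ`. -/
def torsionForm (Ψ : BigEnd E M) (u v w : BigField E M) (x : M) : ℝ :=
  skewBracket (fun y ↦ Ψ y (u y)) (fun y ↦ Ψ y (v y)) w x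
    + skewBracket u (fun y ↦ Ψ y (v y)) (fun y ↦ Ψ y (w y)) x
    + skewBracket (fun y ↦ Ψ y (u y)) v (fun y ↦ Ψ y (w y)) x
    - skewBracket u v w x

/-- Rotation permutes the three terms in which two of the arguments carry `Ψ`. -/
lemma torsionForm_cycl (Ψ : BigEnd E M) (u v w : BigField E M) (x : M) :
    torsionForm Ψ u v w x = torsionForm Ψ v w u x := by
  simp only [torsionForm]
  rw [skewBracket_cycl _ _ w, skewBracket_cycl u, skewBracket_cycl _ v, skewBracket_cycl u v w]
  ring

variable {Ψ : BigEnd E M} {A : EndT E M} {P : Sharp E M} {s : Form2 E M}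

lemma HasComponents.smooth (h : HasComponents Ψ A P s) {u : BigField E M}
    (hu : SmoothBigField u) : SmoothBigField (fun x ↦ Ψ x (u x)) := by
  simp only [h.apply]
  exact ⟨(h.smooth_A _ hu.1).add (h.smooth_P _ hu.2),
    (h.smooth_s _ hu.1).sub (h.smooth_comp _ hu.2)⟩

lemma HasComponents.skew (h : HasComponents Ψ A P s) {x : M} (u v : BigTangent E x) :
    bigPairing (Ψ x u) v = -bigPairing u (Ψ x v) := by
  simp only [bigPairing, h.apply]
  have h1 := h.P_skew x u.2 v.2
  have h2 := h.s_skew x u.1 v.1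
  simp
  linear_combination h1 + h2

lemma HasComponents.sq (h : HasComponents Ψ A P s) {x : M} (u : BigTangent E x) :
    Ψ x (Ψ x u) = -u := by
  simp only [h.apply]
  refine Prod.ext ?_ ?_
  · have : P x ((s x) u.1 - u.2.comp (A x)) = P x (s x u.1) - P x (u.2.comp (A x)) := map_sub _ _ _
    simp [h.A_A, h.A_P]
  · ext v
    have h1 := h.s_A x u.1 v
    have h2 := h.s_skew x (P x u.2) v
    have h3 := h.P_skew x u.2 (s x v)
    have h4 := congrArg u.2 (h.A_A x v)
    simp at h4 ⊢
    linear_combination h1 + h2 - h3 + h4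

/-- Skewness moves the outer `Ψ` onto `w`. The derivatives along `Ψu` and `Ψv` then cancel by
skewness, and those along `u` and `v` cancel because `Ψ` preserves the pairing. -/
lemma bigPairing_torsion (h : HasComponents Ψ A P s) {u v w : BigField E M}
    (hu : SmoothBigField u) (hv : SmoothBigField v) (hw : SmoothBigField w) (x : M) :
    bigPairing (courantTorsion Ψ u v x) (w x) = torsionForm Ψ u v w x := by
  have hadd (a b c d e : BigTangent E x) : bigPairing (a - b - c + d) e =
      bigPairing a e - bigPairing b e - bigPairing c e + bigPairing d e := by
    simp [bigPairing]; ring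
  have hneg (a b : BigTangent E x) : bigPairing (-a) b = -bigPairing a b := by
    simp [bigPairing]; ring
  have hneg' (y : M) (a b : BigTangent E y) : bigPairing a (-b) = -bigPairing a b := by
    simp [bigPairing]; ring
  simp only [courantTorsion, torsionForm]
  rw [hadd, h.sq, hneg, h.skew, h.skew, bigPairing_courantBracket (h.smooth hu) (h.smooth hv) hw,
    bigPairing_courantBracket hu (h.smooth hv) (w := fun y ↦ Ψ y (w y)) (h.smooth hw),
    bigPairing_courantBracket (h.smooth hu) hv (w := fun y ↦ Ψ y (w y)) (h.smooth hw),
    bigPairing_courantBracket hu hv hw]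
  simp only [h.skew, h.sq, hneg', dFun_neg_apply]
  ring

lemma torsionForm_add (h : HasComponents Ψ A P s) {u u' v w : BigField E M}
    (hu : SmoothBigField u) (hu' : SmoothBigField u')
    (hv : SmoothBigField v) (hw : SmoothBigField w) (x : M) :
    torsionForm Ψ (fun y ↦ u y + u' y) v w x = torsionForm Ψ u v w x + torsionForm Ψ u' v w x := by
  have e : (fun y ↦ Ψ y (u y + u' y)) = fun y ↦ Ψ y (u y) + Ψ y (u' y) := by
    ext1 y; exact (Ψ y).map_add _ _
  simp only [torsionForm, e]
  rw [skewBracket_add (h.smooth hu) (h.smooth hu') (h.smooth hv) hw,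
    skewBracket_add hu hu' (h.smooth hv) (h.smooth hw),
    skewBracket_add (h.smooth hu) (h.smooth hu') hv (h.smooth hw), skewBracket_add hu hu' hv hw]
  ring

end Pairing

/-! ### The classical components of the torsion -/

section Torsion

variable {E : Type*} [NormedAddCommGroup E] [NormedSpace ℝ E] [FiniteDimensional ℝ E]
  {M : Type*} [TopologicalSpace M] [ChartedSpace E M] [IsManifold 𝓘(ℝ, E) ∞ M]

/-- Each tangent vector extends to a field differentiable at `x`, and such fields are exactly those
on which `lieDeriv1_apply` can be used. -/
lemma cotangent_ext {x : M} {l l' : Cotangent E x}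
    (h : ∀ Z : VField E M, DiffVFieldAt Z x → l (Z x) = l' (Z x)) : l = l' := by
  ext v
  have := h (FiberBundle.extend E v) (FiberBundle.mdifferentiableAt_extend 𝓘(ℝ, E) E v)
  simpa using this

/-- Agreement with a covector already makes `F` tensorial, so the default value 0 of `covectorAt`
does not arise. -/
lemma covectorAt_eq {F : VField E M → ℝ} {x : M} {l : Cotangent E x}
    (h : ∀ Z : VField E M, DiffVFieldAt Z x → F Z = l (Z x)) : covectorAt F x = l := by
  have hF : TensorialAt 𝓘(ℝ, E) E F x := by
    refine ⟨fun hf hZ ↦ ?_, fun hZ hZ' ↦ ?_⟩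
    · rw [h _ hZ, h _ (hf.smul_section hZ)]
      simp
    · rw [h _ hZ, h _ hZ', h _ (mdifferentiableAt_add_section hZ hZ')]
      simp
  refine cotangent_ext fun Z hZ ↦ ?_
  rw [covectorAt_apply hF hZ, h Z hZ]

lemma mlieBracket_zero_left_apply (X : VField E M) (x : M) :
    mlieBracket 𝓘(ℝ, E) (fun y ↦ (0 : TangentSpace 𝓘(ℝ, E) y)) X x = 0 :=
  congrFun (mlieBracket_zero_left (I := 𝓘(ℝ, E)) (W := X)) x

lemma mlieBracket_zero_right_apply (X : VField E M) (x : M) :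
    mlieBracket 𝓘(ℝ, E) X (fun y ↦ (0 : TangentSpace 𝓘(ℝ, E) y)) x = 0 :=
  congrFun (mlieBracket_zero_right (I := 𝓘(ℝ, E)) (W := X)) x

lemma dFun_zero (x : M) : dFun (E := E) (fun _ : M ↦ (0 : ℝ)) x = 0 :=
  mvfderiv_const (I := 𝓘(ℝ, E)) (0 : ℝ)

lemma dFun_neg (f : M → ℝ) (x : M) : dFun (E := E) (fun y ↦ -f y) x = -dFun f x :=
  mvfderiv_neg (g := f)

lemma lieDeriv1_zero_right (X : VField E M) (x : M) :
    lieDeriv1 X (fun y ↦ (0 : Cotangent E y)) x = 0 := by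
  refine cotangent_ext fun Z hZ ↦ ?_
  rw [lieDeriv1_apply X (fun y ↦ (0 : Cotangent E y)) x smoothForm1_zero hZ]
  simp [dFun_zero]

lemma lieDeriv1_zero_left {α : Form1 E M} (hα : SmoothForm1 α) (x : M) :
    lieDeriv1 (fun y ↦ (0 : TangentSpace 𝓘(ℝ, E) y)) α x = 0 := by
  refine cotangent_ext fun Z hZ ↦ ?_
  rw [lieDeriv1_apply _ α x hα hZ, mlieBracket_zero_left_apply]
  simp

lemma lieDeriv1_neg (X : VField E M) {α : Form1 E M} (hα : SmoothForm1 α) (x : M) :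
    lieDeriv1 X (fun y ↦ -α y) x = -lieDeriv1 X α x := by
  refine cotangent_ext fun Z hZ ↦ ?_
  rw [lieDeriv1_apply X (fun y ↦ -α y) x hα.neg hZ]
  simp only [neg_apply, dFun_neg_apply, lieDeriv1_apply X α x hα hZ]
  ring

variable {Ψ : BigEnd E M} {A : EndT E M} {P : Sharp E M} {s : Form2 E M}

/-- Cartan's formula for `i(X ∧ Y) dσ`: it is linear in the value of `Z` and uses the same Lie
derivatives as the Courant bracket. -/
lemma HasComponents.extDeriv2_eq_lieDeriv1 (h : HasComponents Ψ A P s) {X Y Z : VField E M}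
    (hX : SmoothVField X) (hY : SmoothVField Y) {x : M} (hZ : DiffVFieldAt Z x) :
    extDeriv2 s X Y Z x = (lieDeriv1 X (fun y ↦ s y (Y y)) x
      - lieDeriv1 Y (fun y ↦ s y (X y)) x + dFun (fun y ↦ s y (X y) (Y y)) x
      - s x (mlieBracket 𝓘(ℝ, E) X Y x) : Cotangent E x) (Z x) := by
  simp only [sub_apply, add_apply, lieDeriv1_apply _ _ x (h.smooth_s Y hY) hZ,
    lieDeriv1_apply _ _ x (h.smooth_s X hX) hZ, extDeriv2]
  have e : (fun y ↦ s y (Z y) (X y)) = fun y ↦ -s y (X y) (Z y) :=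
    funext fun y ↦ h.s_skew y _ _
  rw [e, dFun_neg_apply, h.s_skew x _ (X x), h.s_skew x _ (Y x),
    mlieBracket_swap_apply (V := Z) (W := X)]
  simp only [map_neg]
  ring

lemma HasComponents.contractExtDeriv2_eq (h : HasComponents Ψ A P s) {X Y : VField E M}
    (hX : SmoothVField X) (hY : SmoothVField Y) (x : M) :
    contractExtDeriv2 s X Y x = lieDeriv1 X (fun y ↦ s y (Y y)) x
      - lieDeriv1 Y (fun y ↦ s y (X y)) x + dFun (fun y ↦ s y (X y) (Y y)) x
      - s x (mlieBracket 𝓘(ℝ, E) X Y x) :=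
  covectorAt_eq fun _ hZ ↦ h.extDeriv2_eq_lieDeriv1 hX hY hZ

lemma HasComponents.extDeriv2_eq (h : HasComponents Ψ A P s) {X Y Z : VField E M}
    (hX : SmoothVField X) (hY : SmoothVField Y) {x : M} (hZ : DiffVFieldAt Z x) :
    extDeriv2 s X Y Z x = contractExtDeriv2 s X Y x (Z x) := by
  rw [h.extDeriv2_eq_lieDeriv1 hX hY hZ, h.contractExtDeriv2_eq hX hY]

/-- The halves of exact terms in the two mixed Courant brackets add up, by skewness of `π`, to the
full differential in `formBracket`. -/
lemma HasComponents.torsion_form_form_fst (h : HasComponents Ψ A P s) {α β : Form1 E M}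
    (hα : SmoothForm1 α) (hβ : SmoothForm1 β) (x : M) :
    (courantTorsion Ψ (fun y ↦ (0, α y)) (fun y ↦ (0, β y)) x).1 =
      mlieBracket 𝓘(ℝ, E) (fun y ↦ P y (α y)) (fun y ↦ P y (β y)) x
        - P x (formBracket P α β x) := by
  have e : (fun y ↦ α y (P y (β y))) = fun y ↦ -β y (P y (α y)) :=
    funext fun y ↦ h.P_skew y _ _
  have hcα : SmoothForm1 (fun y ↦ -(α y).comp (A y)) := (h.smooth_comp α hα).neg
  have hcβ : SmoothForm1 (fun y ↦ -(β y).comp (A y)) := (h.smooth_comp β hβ).neg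
  simp only [courantTorsion, courantBracket, formBracket, h.sq, Prod.fst_add, Prod.fst_sub,
    Prod.fst_neg]
  simp only [h.apply, map_zero, zero_add, zero_sub, sub_zero, neg_zero,
    mlieBracket_zero_left_apply, mlieBracket_zero_right_apply, lieDeriv1_zero_left hcα,
    lieDeriv1_zero_left hcβ, e, dFun_neg, map_sub, map_add, map_smul, map_neg]
  module

/-- The two mixed brackets contribute `½ d(α(AX))` with opposite signs, so no exact term survives.
-/
lemma HasComponents.torsion_vec_form_fst (h : HasComponents Ψ A P s) {X : VField E M}
    {α : Form1 E M} (hX : SmoothVField X) (hα : SmoothForm1 α) (x : M) :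
    (courantTorsion Ψ (fun y ↦ (X y, 0)) (fun y ↦ (0, α y)) x).1 = concomitant P A α X x := by
  simp only [courantTorsion, courantBracket, concomitant, lieDerivEnd, h.sq, Prod.fst_add,
    Prod.fst_sub, Prod.fst_neg]
  simp only [h.apply, map_zero, zero_add, zero_sub, sub_zero, neg_zero, add_zero,
    ContinuousLinearMap.zero_comp, zero_apply, neg_apply,
    mlieBracket_zero_right_apply, lieDeriv1_zero_right,
    lieDeriv1_zero_left (h.smooth_s X hX),
    lieDeriv1_neg _ (h.smooth_comp α hα), ContinuousLinearMap.comp_apply, dFun_neg,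
    map_sub, map_add, map_smul, map_neg]
  rw [mlieBracket_swap_apply (V := X), mlieBracket_swap_apply (V := fun y ↦ A y (X y))]
  simp only [map_neg]
  module

/-- The last torsion term is `-[X, Y]`. Writing it as `A²[X, Y] + ♯_π ♭_σ [X, Y]` completes both the
Nijenhuis tensor and the Cartan formula for `dσ`. -/
lemma HasComponents.torsion_vec_vec_fst (h : HasComponents Ψ A P s) {X Y : VField E M}
    (hX : SmoothVField X) (hY : SmoothVField Y) (x : M) :
    (courantTorsion Ψ (fun y ↦ (X y, 0)) (fun y ↦ (Y y, 0)) x).1 =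
      nijenhuis A X Y x - P x (contractExtDeriv2 s X Y x) := by
  have e : (fun y ↦ s y (Y y) (X y)) = fun y ↦ -s y (X y) (Y y) :=
    funext fun y ↦ h.s_skew y _ _
  rw [h.contractExtDeriv2_eq hX hY]
  simp only [courantTorsion, courantBracket, nijenhuis, h.sq, Prod.fst_add,
    Prod.fst_sub, Prod.fst_neg]
  simp only [h.apply, map_zero, zero_sub, sub_zero, add_zero,
    ContinuousLinearMap.zero_comp, zero_apply, lieDeriv1_zero_right, e, dFun_neg, h.A_A,
    map_sub, map_add, map_smul, map_neg]
  module

lemma HasComponents.torsion_vec_vec_snd (h : HasComponents Ψ A P s) {X Y Z : VField E M}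
    (hX : SmoothVField X) (hY : SmoothVField Y) (hZ : SmoothVField Z) (x : M) :
    (courantTorsion Ψ (fun y ↦ (X y, 0)) (fun y ↦ (Y y, 0)) x).2 (Z x) =
      -(extDeriv2 (fun y ↦ (s y).comp (A y)) X Y Z x
        - (extDeriv2 s (fun y ↦ A y (X y)) Y Z x + extDeriv2 s (fun y ↦ A y (Y y)) Z X x
          + extDeriv2 s (fun y ↦ A y (Z y)) X Y x)) := by
  have sk (V W : VField E M) : (fun y ↦ s y (V y) (W y)) = fun y ↦ -s y (W y) (V y) :=
    funext fun y ↦ h.s_skew y _ _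
  have sA (V W : VField E M) : (fun y ↦ s y (V y) (A y (W y))) = fun y ↦ s y (A y (V y)) (W y) :=
    funext fun y ↦ (h.s_A y _ _).symm
  have sA' (V W : VField E M) :
      (fun y ↦ s y (A y (V y)) (W y)) = fun y ↦ -s y (A y (W y)) (V y) :=
    funext fun y ↦ by rw [h.s_A, h.s_skew]
  -- Since `σ_A` is skew, the exact term of the Courant bracket is `d` of twice `σ_A(X, Y)/2`, with
  -- both copies kept for `dFun_add_apply`.
  have e (y : M) : s y (X y) (A y (Y y)) - s y (Y y) (A y (X y)) =
      s y (A y (X y)) (Y y) + s y (A y (X y)) (Y y) := by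
    rw [h.s_A, h.s_skew y (Y y), h.s_A]; ring
  have dX := mdifferentiableAt_pairing (h.smooth_s _ (h.smooth_A X hX)) hY x
  -- The form part of `Ψ` composes with `A`, so Lie derivatives are also evaluated on the field
  -- `AZ`.
  have hAZ : DiffVFieldAt (fun y ↦ A y (Z y)) x := (h.smooth_A Z hZ).diffVFieldAt x
  have L (V W : VField E M) (hW : SmoothVField W) :
      lieDeriv1 V (fun y ↦ s y (W y)) x (Z x) = _ :=
    lieDeriv1_apply V _ x (h.smooth_s W hW) (hZ.diffVFieldAt x)
  have LA (V W : VField E M) (hW : SmoothVField W) :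
      lieDeriv1 V (fun y ↦ s y (W y)) x (A x (Z x)) = _ :=
    lieDeriv1_apply V _ x (h.smooth_s W hW) hAZ
  simp only [courantTorsion, courantBracket, h.sq, Prod.snd_add,
    Prod.snd_sub, Prod.snd_neg]
  simp only [h.apply, map_zero, zero_sub, sub_zero, add_zero, sub_self,
    ContinuousLinearMap.zero_comp, zero_apply, lieDeriv1_zero_right, dFun_zero, smul_zero,
    neg_zero, e, sub_apply, add_apply, neg_apply, smul_apply, ContinuousLinearMap.comp_apply,
    L _ _ hX, L _ _ hY, LA _ _ hX, LA _ _ hY, dFun_neg_apply, dFun_add_apply dX dX, extDeriv2,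
    smul_eq_mul]
  -- The symmetries of `σ` and `σ_A` bring the derivatives, and then the brackets, on both sides to
  -- a common form.
  rw [sA Y Z, sA X Z, sA' X Z, sA X Y, sA Z X, sk X Z, sk Y X]
  simp only [dFun_neg_apply, h.s_A]
  rw [h.s_skew x (Y x) (mlieBracket 𝓘(ℝ, E) (fun y ↦ A y (X y)) Z x),
    h.s_skew x (X x) (mlieBracket 𝓘(ℝ, E) (fun y ↦ A y (Y y)) Z x),
    h.s_skew x (Y x) (mlieBracket 𝓘(ℝ, E) X (fun y ↦ A y (Z y)) x),
    h.s_skew x (X x) (mlieBracket 𝓘(ℝ, E) Y (fun y ↦ A y (Z y)) x),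
    mlieBracket_swap_apply (V := Z) (W := fun y ↦ A y (X y)),
    mlieBracket_swap_apply (V := X) (W := fun y ↦ A y (Z y))]
  simp only [map_neg, neg_apply]
  ring

end Torsion

/-! ### Integrability in terms of the classical components -/

section Integrability

variable {E : Type*} [NormedAddCommGroup E] [NormedSpace ℝ E] [FiniteDimensional ℝ E]
  {M : Type*} [TopologicalSpace M] [ChartedSpace E M] [IsManifold 𝓘(ℝ, E) ∞ M]
  {Ψ : BigEnd E M} {A : EndT E M} {P : Sharp E M} {s : Form2 E M}

/-- `[π, π]` measures the failure of `♯_π` to carry the bracket of 1-forms to the Lie bracket, which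
is the torsion on two 1-forms. -/
lemma schouten_self_eq (P : Sharp E M) (α β γ : Form1 E M) (x : M) :
    schouten P P α β γ x = -2 * γ x (mlieBracket 𝓘(ℝ, E) (fun y ↦ P y (α y)) (fun y ↦ P y (β y)) x
      - P x (formBracket P α β x)) := by
  simp only [schouten, map_sub, map_add]
  ring

lemma torsionForm_eq_zero (h : HasComponents Ψ A P s)
    (hvvv : ∀ X Y Z : VField E M, SmoothVField X → SmoothVField Y → SmoothVField Z → ∀ x,
      torsionForm Ψ (fun y ↦ (X y, 0)) (fun y ↦ (Y y, 0)) (fun y ↦ (Z y, 0)) x = 0)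
    (hvvf : ∀ (X Y : VField E M) (γ : Form1 E M), SmoothVField X → SmoothVField Y →
      SmoothForm1 γ → ∀ x,
      torsionForm Ψ (fun y ↦ (X y, 0)) (fun y ↦ (Y y, 0)) (fun y ↦ (0, γ y)) x = 0)
    (hvff : ∀ (X : VField E M) (β γ : Form1 E M), SmoothVField X → SmoothForm1 β →
      SmoothForm1 γ → ∀ x,
      torsionForm Ψ (fun y ↦ (X y, 0)) (fun y ↦ (0, β y)) (fun y ↦ (0, γ y)) x = 0)
    (hfff : ∀ α β γ : Form1 E M, SmoothForm1 α → SmoothForm1 β → SmoothForm1 γ → ∀ x,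
      torsionForm Ψ (fun y ↦ (0, α y)) (fun y ↦ (0, β y)) (fun y ↦ (0, γ y)) x = 0)
    {u v w : BigField E M} (hu : SmoothBigField u) (hv : SmoothBigField v)
    (hw : SmoothBigField w) (x : M) : torsionForm Ψ u v w x = 0 := by
  have sv {X : VField E M} (hX : SmoothVField X) : SmoothBigField (fun y ↦ (X y, 0)) :=
    ⟨hX, smoothForm1_zero⟩
  have sf {α : Form1 E M} (hα : SmoothForm1 α) : SmoothBigField (fun y ↦ (0, α y)) :=
    ⟨smoothVField_zero, hα⟩
  have dec (u : BigField E M) : u = fun y ↦ (((u y).1, 0) : BigTangent E y) + (0, (u y).2) :=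
    funext fun y ↦ Prod.ext (add_zero _).symm (zero_add _).symm
  have split {u v w : BigField E M} (hu : SmoothBigField u) (hv : SmoothBigField v)
      (hw : SmoothBigField w)
      (h1 : torsionForm Ψ (fun y ↦ ((u y).1, 0)) v w x = 0)
      (h2 : torsionForm Ψ (fun y ↦ (0, (u y).2)) v w x = 0) : torsionForm Ψ u v w x = 0 := by
    rw [dec u, torsionForm_add h (sv hu.1) (sf hu.2) hv hw, h1, h2, add_zero]
  have svu := sv hu.1
  have sfu := sf hu.2
  have svv := sv hv.1
  have sfv := sf hv.2
  -- Only the first slot can be split, so each splitting is followed by a rotation bringing the next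
  -- slot to the front; a last rotation matches one of the four types.
  refine split hu hv hw ?_ ?_ <;> rw [torsionForm_cycl]
  · refine split hv hw svu ?_ ?_ <;> rw [torsionForm_cycl]
    · refine split hw svu svv ?_ ?_
      · exact hvvv _ _ _ hw.1 hu.1 hv.1 x
      · rw [torsionForm_cycl]
        exact hvvf _ _ _ hu.1 hv.1 hw.2 x
    · refine split hw svu sfv ?_ ?_
      · exact hvvf _ _ _ hw.1 hu.1 hv.2 x
      · rw [torsionForm_cycl]
        exact hvff _ _ _ hu.1 hv.2 hw.2 x
  · refine split hv hw sfu ?_ ?_ <;> rw [torsionForm_cycl]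
    · refine split hw sfu svv ?_ ?_ <;> rw [torsionForm_cycl, torsionForm_cycl]
      · exact hvvf _ _ _ hv.1 hw.1 hu.2 x
      · exact hvff _ _ _ hv.1 hw.2 hu.2 x
    · refine split hw sfu sfv ?_ ?_
      · exact hvff _ _ _ hw.1 hu.2 hv.2 x
      · exact hfff _ _ _ hw.2 hu.2 hv.2 x

/-- Necessity reads off components of the torsion. Sufficiency kills its pairing with every smooth
section and uses nondegeneracy. -/
lemma isIntegrable_iff [T2Space M] (h : HasComponents Ψ A P s) :
    IsIntegrable Ψ ↔
      (∀ α β γ : Form1 E M, SmoothForm1 α → SmoothForm1 β → SmoothForm1 γ →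
        ∀ x, schouten P P α β γ x = 0) ∧
      (∀ (α : Form1 E M) (X : VField E M), SmoothForm1 α → SmoothVField X →
        ∀ x, concomitant P A α X x = 0) ∧
      (∀ X Y : VField E M, SmoothVField X → SmoothVField Y →
        ∀ x, nijenhuis A X Y x - P x (contractExtDeriv2 s X Y x) = 0) ∧
      (∀ X Y Z : VField E M, SmoothVField X → SmoothVField Y → SmoothVField Z →
        ∀ x, extDeriv2 (fun y ↦ (s y).comp (A y)) X Y Z x
          - (extDeriv2 s (fun y ↦ A y (X y)) Y Z x + extDeriv2 s (fun y ↦ A y (Y y)) Z X x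
            + extDeriv2 s (fun y ↦ A y (Z y)) X Y x) = 0) := by
  constructor
  · intro H
    have H1 (u v : BigField E M) (hu : SmoothBigField u) (hv : SmoothBigField v) (x : M) :
        courantTorsion Ψ u v x = 0 := H u v hu.1 hu.2 hv.1 hv.2 x
    refine ⟨fun α β γ hα hβ hγ x ↦ ?_, fun α X hα hX x ↦ ?_, fun X Y hX hY x ↦ ?_,
      fun X Y Z hX hY hZ x ↦ ?_⟩
    · rw [schouten_self_eq, ← h.torsion_form_form_fst hα hβ,
        H1 (fun y ↦ (0, α y)) (fun y ↦ (0, β y)) ⟨smoothVField_zero, hα⟩ ⟨smoothVField_zero, hβ⟩]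
      simp
    · rw [← h.torsion_vec_form_fst hX hα,
        H1 (fun y ↦ (X y, 0)) (fun y ↦ (0, α y)) ⟨hX, smoothForm1_zero⟩ ⟨smoothVField_zero, hα⟩]
      rfl
    · rw [← h.torsion_vec_vec_fst hX hY,
        H1 (fun y ↦ (X y, 0)) (fun y ↦ (Y y, 0)) ⟨hX, smoothForm1_zero⟩ ⟨hY, smoothForm1_zero⟩]
      rfl
    · rw [← neg_eq_zero, ← h.torsion_vec_vec_snd hX hY hZ,
        H1 (fun y ↦ (X y, 0)) (fun y ↦ (Y y, 0)) ⟨hX, smoothForm1_zero⟩ ⟨hY, smoothForm1_zero⟩]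
      rfl
  · rintro ⟨H1, H2, H3, H4⟩ u v hu1 hu2 hv1 hv2 x
    have sv {X : VField E M} (hX : SmoothVField X) : SmoothBigField (fun y ↦ (X y, 0)) :=
      ⟨hX, smoothForm1_zero⟩
    have sf {α : Form1 E M} (hα : SmoothForm1 α) : SmoothBigField (fun y ↦ (0, α y)) :=
      ⟨smoothVField_zero, hα⟩
    have key {w : BigField E M} (hw : SmoothBigField w) : torsionForm Ψ u v w x = 0 := by
      refine torsionForm_eq_zero h ?_ ?_ ?_ ?_ ⟨hu1, hu2⟩ ⟨hv1, hv2⟩ hw x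
      · intro X Y Z hX hY hZ x
        rw [← bigPairing_torsion h (sv hX) (sv hY) (sv hZ), bigPairing]
        simp only [h.torsion_vec_vec_snd hX hY hZ, H4 X Y Z hX hY hZ]
        simp
      · intro X Y γ hX hY hγ x
        rw [← bigPairing_torsion h (sv hX) (sv hY) (sf hγ), bigPairing]
        simp [h.torsion_vec_vec_fst hX hY, H3 X Y hX hY]
      · intro X β γ hX hβ hγ x
        rw [← bigPairing_torsion h (sv hX) (sf hβ) (sf hγ), bigPairing]
        simp [h.torsion_vec_form_fst hX hβ, H2 β X hβ hX]
      · intro α β γ hα hβ hγ x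
        have := H1 α β γ hα hβ hγ x
        rw [schouten_self_eq, ← h.torsion_form_form_fst hα hβ] at this
        rw [← bigPairing_torsion h (sf hα) (sf hβ) (sf hγ), bigPairing]
        simp only [map_zero, zero_add]
        linarith
    refine Prod.ext ?_ ?_
    · refine SeparatingDual.eq_zero_of_forall_dual_eq_zero (V := E) (R := ℝ) fun a ↦ ?_
      obtain ⟨γ, hγ, hγx⟩ := exists_smoothForm1_apply_eq (x := x) (a : Cotangent E x)
      have := key (sf hγ)
      rw [← bigPairing_torsion h ⟨hu1, hu2⟩ ⟨hv1, hv2⟩ (sf hγ), bigPairing, hγx] at this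
      simp only [map_zero, zero_add] at this
      exact this
    · ext z
      obtain ⟨Z, hZ, rfl⟩ := exists_smoothVField_apply_eq z
      have := key (sv hZ)
      rw [← bigPairing_torsion h ⟨hu1, hu2⟩ ⟨hv1, hv2⟩ (sv hZ), bigPairing] at this
      simpa using this

end Integrability

/-! ### Rescaling the classical components -/

section Rescaling

variable {E : Type*} [NormedAddCommGroup E] [NormedSpace ℝ E] [FiniteDimensional ℝ E]
  {M : Type*} [TopologicalSpace M] [ChartedSpace E M] [IsManifold 𝓘(ℝ, E) ∞ M]
  {Ψ : BigEnd E M} {A : EndT E M} {P : Sharp E M} {s : Form2 E M} {f : M → ℝ}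

lemma lieDeriv1_smul_left {α : Form1 E M} (hα : SmoothForm1 α) {X : VField E M} {x : M}
    (hf : MDifferentiableAt 𝓘(ℝ, E) 𝓘(ℝ, ℝ) f x) (hX : DiffVFieldAt X x) :
    lieDeriv1 (fun y ↦ f y • X y) α x = f x • lieDeriv1 X α x + α x (X x) • dFun f x := by
  refine cotangent_ext fun Z hZ ↦ ?_
  have e : mlieBracket 𝓘(ℝ, E) (fun y ↦ f y • X y) Z x = _ := mlieBracket_smul_left hf hX
  simp only [add_apply, smul_apply, lieDeriv1_apply _ α x hα hZ]
  rw [e]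
  simp
  ring

/-- Every term is either `f²` times an undifferentiated one or contains `df` once, with one factor
`f` left over. -/
lemma HasComponents.schouten_smul (h : HasComponents Ψ A P s) {α β γ : Form1 E M}
    (hα : SmoothForm1 α) (hβ : SmoothForm1 β) {x : M}
    (hf : MDifferentiableAt 𝓘(ℝ, E) 𝓘(ℝ, ℝ) f x) :
    schouten (fun y ↦ f y • P y) (fun y ↦ f y • P y) α β γ x =
      f x ^ 2 * schouten P P α β γ x
        + 2 * f x * wedgeVecBivector (P x (dFun f x)) (P x) (α x) (β x) (γ x) := by
  have dα := (h.smooth_P α hα).diffVFieldAt x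
  have dβ := (h.smooth_P β hβ).diffVFieldAt x
  have b1 (W : VField E M) :
      mlieBracket 𝓘(ℝ, E) (fun y ↦ f y • P y (α y)) W x = _ := mlieBracket_smul_left hf dα
  have b2 (W : VField E M) :
      mlieBracket 𝓘(ℝ, E) W (fun y ↦ f y • P y (β y)) x = _ := mlieBracket_smul_right hf dβ
  have e : dFun (E := E) (fun y ↦ f y * β y (P y (α y))) x = f x • dFun (fun y ↦ β y (P y (α y))) x
      + β x (P x (α x)) • dFun f x := by
    ext v
    exact dFun_mul_apply hf (mdifferentiableAt_pairing hβ (h.smooth_P α hα) x) v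
  have p1 := h.P_skew x (α x) (dFun f x)
  have p2 := h.P_skew x (β x) (dFun f x)
  have p3 := h.P_skew x (α x) (γ x)
  have p4 := h.P_skew x (α x) (β x)
  simp only [schouten_self_eq, formBracket, smul_apply, map_smul, smul_eq_mul,
    lieDeriv1_smul_left hα hf dβ, lieDeriv1_smul_left hβ hf dα, e, b1, b2, wedgeVecBivector,
    map_add, map_sub]
  simp
  -- Skewness of `π` turns `df(♯α)` and `df(♯β)` into pairings with `♯df` and orders the remaining
  -- pairings.
  linear_combination (-2 * f x * γ x (P x (β x))) * p1 + (2 * f x * γ x (P x (α x))) * p2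
    - (2 * f x * β x (P x (dFun f x))) * p3 - (2 * f x * γ x (P x (dFun f x))) * p4

/-- The function `f` is differentiated only in the Lie derivative of `A` along `f ♯α`. -/
lemma HasComponents.concomitant_smul (h : HasComponents Ψ A P s) {α : Form1 E M} {X : VField E M}
    (hα : SmoothForm1 α) {x : M} (hf : MDifferentiableAt 𝓘(ℝ, E) 𝓘(ℝ, ℝ) f x) :
    concomitant (fun y ↦ f y • P y) A α X x = f x • concomitant P A α X x
      + dFun f x (A x (X x)) • P x (α x) - dFun f x (X x) • A x (P x (α x)) := by
  have dα := (h.smooth_P α hα).diffVFieldAt x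
  have b1 (W : VField E M) :
      mlieBracket 𝓘(ℝ, E) (fun y ↦ f y • P y (α y)) W x = _ := mlieBracket_smul_left hf dα
  simp only [concomitant, lieDerivEnd, smul_apply, b1, map_add, map_smul, map_sub]
  simp
  module

/-- Stated for any smooth skew `s`, so that it covers `σ_A` as well as `σ`. -/
lemma extDeriv2_smul (hs : ∀ X, SmoothVField X → SmoothForm1 (fun x ↦ s x (X x)))
    (skew : ∀ x (v w : TangentSpace 𝓘(ℝ, E) x), s x v w = -s x w v) {X Y Z : VField E M}
    (hX : SmoothVField X) (hY : SmoothVField Y) {x : M} (hZ : DiffVFieldAt Z x)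
    (hf : MDifferentiableAt 𝓘(ℝ, E) 𝓘(ℝ, ℝ) f x) :
    extDeriv2 (fun y ↦ f y • s y) X Y Z x = f x * extDeriv2 s X Y Z x
      + wedgeForm12 (dFun f x) (s x) (X x) (Y x) (Z x) := by
  have e : (fun y ↦ s y (Z y) (X y)) = fun y ↦ -s y (X y) (Z y) :=
    funext fun y ↦ skew y _ _
  have d1 := differentiableAt_pairing _ (hs Y hY) hZ
  have d2 := mdifferentiableAt_pairing (hs X hX) hY x
  -- `Z` is only differentiable at `x`, so smoothness of `s` is applied to `X` after exchanging the
  -- arguments.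
  have d3 : MDifferentiableAt 𝓘(ℝ, E) 𝓘(ℝ, ℝ) (fun y ↦ s y (Z y) (X y)) x := by
    rw [e]; exact (differentiableAt_pairing _ (hs X hX) hZ).neg
  simp only [extDeriv2, smul_apply, smul_eq_mul, dFun_mul_apply hf d1, dFun_mul_apply hf d2,
    dFun_mul_apply hf d3, wedgeForm12]
  ring

lemma HasComponents.contractExtDeriv2_smul (h : HasComponents Ψ A P s) {X Y : VField E M}
    (hX : SmoothVField X) (hY : SmoothVField Y) {x : M}
    (hf : MDifferentiableAt 𝓘(ℝ, E) 𝓘(ℝ, ℝ) f x) :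
    contractExtDeriv2 (fun y ↦ f y • s y) X Y x = f x • contractExtDeriv2 s X Y x
      + dFun f x (X x) • s x (Y x) - dFun f x (Y x) • s x (X x) + s x (X x) (Y x) • dFun f x := by
  refine covectorAt_eq fun Z hZ ↦ ?_
  rw [extDeriv2_smul h.smooth_s h.s_skew hX hY hZ hf, h.extDeriv2_eq hX hY hZ]
  simp only [wedgeForm12, add_apply, sub_apply, smul_apply, smul_eq_mul, h.s_skew x (Z x)]
  ring

end Rescaling

/-! ### Conformal changes -/

section Conformal

variable {E : Type*} [NormedAddCommGroup E] [NormedSpace ℝ E] [FiniteDimensional ℝ E]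
  {M : Type*} [TopologicalSpace M] [ChartedSpace E M] [IsManifold 𝓘(ℝ, E) ∞ M]
  {Ψ : BigEnd E M} {A : EndT E M} {P : Sharp E M} {s : Form2 E M} {τ : M → ℝ}

lemma dFun_exp {x : M} (hτ : MDifferentiableAt 𝓘(ℝ, E) 𝓘(ℝ, ℝ) τ x) :
    dFun (E := E) (fun y ↦ Real.exp (τ y)) x = Real.exp (τ x) • dFun τ x := by
  ext v
  have h := mvfderiv_comp_apply (I' := 𝓘(ℝ, E)) (I := 𝓘(ℝ, ℝ)) (g := Real.exp) (f := τ) x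
    Real.differentiable_exp.differentiableAt.mdifferentiableAt hτ v
  have k (a w : ℝ) : fderiv ℝ Real.exp a w = Real.exp a * w := by
    rw [(Real.hasDerivAt_exp a).hasFDerivAt.fderiv]
    simp [mul_comm]
  refine h.trans ?_
  change mfderiv 𝓘(ℝ, ℝ) 𝓘(ℝ, ℝ) Real.exp (τ x) _ = _
  rw [mfderiv_eq_fderiv]
  exact k _ _

/-- Each classical equation for `(A, e^τ π, e^{-τ} σ)` is, up to a nonzero factor, the corresponding
equation for `(A, π, σ)` with its `dτ` terms. -/
lemma HasComponents.isIntegrable_conformalChange_iff [T2Space M] (h : HasComponents Ψ A P s)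
    (hτ : ContMDiff 𝓘(ℝ, E) 𝓘(ℝ, ℝ) ∞ τ) :
    IsIntegrable (conformalChange τ Ψ) ↔
      (∀ α β γ : Form1 E M, SmoothForm1 α → SmoothForm1 β → SmoothForm1 γ →
        ∀ x, schouten P P α β γ x
          = -2 * wedgeVecBivector (P x (dFun τ x)) (P x) (α x) (β x) (γ x)) ∧
      (∀ (α : Form1 E M) (X : VField E M), SmoothForm1 α → SmoothVField X →
        ∀ x, concomitant P A α X x
          = dFun τ x (X x) • A x (P x (α x)) - dFun τ x (A x (X x)) • P x (α x)) ∧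
      (∀ X Y : VField E M, SmoothVField X → SmoothVField Y →
        ∀ x, nijenhuis A X Y x - P x (contractExtDeriv2 s X Y x)
          = -(s x (X x) (Y x) • P x (dFun τ x))
            + dFun τ x (X x) • (Y x + A x (A x (Y x)))
            - dFun τ x (Y x) • (X x + A x (A x (X x)))) ∧
      (∀ X Y Z : VField E M, SmoothVField X → SmoothVField Y → SmoothVField Z →
        ∀ x, extDeriv2 (fun y ↦ (s y).comp (A y)) X Y Z x
            - (extDeriv2 s (fun y ↦ A y (X y)) Y Z x + extDeriv2 s (fun y ↦ A y (Y y)) Z X x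
              + extDeriv2 s (fun y ↦ A y (Z y)) X Y x)
          = -(wedgeForm12 (dFun τ x) ((s x).comp (A x)) (X x) (Y x) (Z x)
              + wedgeForm12 ((dFun τ x).comp (A x)) (s x) (X x) (Y x) (Z x))) := by
  have hτx (x : M) : MDifferentiableAt 𝓘(ℝ, E) 𝓘(ℝ, ℝ) τ x := (hτ x).mdifferentiableAt (by simp)
  have hf (x : M) : MDifferentiableAt 𝓘(ℝ, E) 𝓘(ℝ, ℝ) (fun y ↦ Real.exp (τ y)) x :=
    (Real.differentiable_exp _).mdifferentiableAt.comp x (hτx x)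
  have hg (x : M) : MDifferentiableAt 𝓘(ℝ, E) 𝓘(ℝ, ℝ) (fun y ↦ Real.exp (-τ y)) x :=
    (Real.differentiable_exp _).mdifferentiableAt.comp x (hτx x).neg
  have df (x : M) := dFun_exp (hτx x)
  have dg (x : M) : dFun (E := E) (fun y ↦ Real.exp (-τ y)) x = -(Real.exp (-τ x) • dFun τ x) := by
    have := dFun_exp (hτx x).neg
    have e : dFun (E := E) (-τ) x = -dFun τ x := dFun_neg τ x
    rw [e, smul_neg] at this
    exact this
  have ee (x : M) : Real.exp (τ x) * Real.exp (-τ x) = 1 := by rw [← Real.exp_add]; simp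
  have hsA (X : VField E M) (hX : SmoothVField X) :
      SmoothForm1 (fun x ↦ ((s x).comp (A x)) (X x)) := h.smooth_s _ (h.smooth_A X hX)
  have skA (x : M) (v w : TangentSpace 𝓘(ℝ, E) x) :
      ((s x).comp (A x)) v w = -((s x).comp (A x)) w v := by
    simp only [ContinuousLinearMap.comp_apply]
    rw [h.s_A, h.s_skew]
  rw [isIntegrable_iff (conformalChange_hasComponents h hτ)]
  refine and_congr ?_ (and_congr ?_ (and_congr ?_ ?_))
  · refine forall_congr' fun α ↦ forall_congr' fun β ↦ forall_congr' fun γ ↦ forall_congr' fun hα ↦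
      forall_congr' fun hβ ↦ forall_congr' fun hγ ↦ forall_congr' fun x ↦ ?_
    rw [h.schouten_smul hα hβ (hf x), df]
    -- The differential `e^τ dτ` supplies the second exponential, so `e^{2τ}` is a common factor.
    have e : Real.exp (τ x) ^ 2 * schouten P P α β γ x + 2 * Real.exp (τ x) *
        wedgeVecBivector (P x (Real.exp (τ x) • dFun τ x)) (P x) (α x) (β x) (γ x) =
        Real.exp (τ x) ^ 2 * (schouten P P α β γ x
          + 2 * wedgeVecBivector (P x (dFun τ x)) (P x) (α x) (β x) (γ x)) := by
      simp only [wedgeVecBivector, map_smul, smul_eq_mul]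
      ring
    rw [e, mul_eq_zero, or_iff_right (by positivity), add_eq_zero_iff_eq_neg, neg_mul]
  · refine forall_congr' fun α ↦ forall_congr' fun X ↦ forall_congr' fun hα ↦
      forall_congr' fun hX ↦ forall_congr' fun x ↦ ?_
    rw [h.concomitant_smul hα (hf x), df]
    have e : Real.exp (τ x) • concomitant P A α X x
        + (Real.exp (τ x) • dFun τ x) (A x (X x)) • P x (α x)
        - (Real.exp (τ x) • dFun τ x) (X x) • A x (P x (α x)) =
        Real.exp (τ x) • (concomitant P A α X x
          - (dFun τ x (X x) • A x (P x (α x)) - dFun τ x (A x (X x)) • P x (α x))) := by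
      simp only [smul_apply, smul_eq_mul]
      module
    rw [e, smul_eq_zero_iff_right (Real.exp_pos _).ne', sub_eq_zero]
  · refine forall_congr' fun X ↦ forall_congr' fun Y ↦ forall_congr' fun hX ↦
      forall_congr' fun hY ↦ forall_congr' fun x ↦ ?_
    rw [h.contractExtDeriv2_smul hX hY (hg x), dg]
    have e : Real.exp (-τ x) • contractExtDeriv2 s X Y x
          + (-(Real.exp (-τ x) • dFun τ x)) (X x) • s x (Y x)
          - (-(Real.exp (-τ x) • dFun τ x)) (Y x) • s x (X x)
          + s x (X x) (Y x) • (-(Real.exp (-τ x) • dFun τ x)) =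
        Real.exp (-τ x) • (contractExtDeriv2 s X Y x - dFun τ x (X x) • s x (Y x)
          + dFun τ x (Y x) • s x (X x) - s x (X x) (Y x) • dFun τ x) := by
      simp only [neg_apply, smul_apply, smul_eq_mul]
      module
    -- The factors of `π` and `dσ` cancel here. The term `Y + A²Y` in the equation is `-♯_π ♭_σ Y`
    -- by `A_A`.
    rw [e, smul_apply, map_smul, smul_smul, ee, one_smul, ← sub_eq_zero (b := _ - _)]
    simp only [map_add, map_sub, map_smul, h.A_A]
    refine Eq.congr_left ?_
    module
  · refine forall_congr' fun X ↦ forall_congr' fun Y ↦ forall_congr' fun Z ↦ forall_congr' fun hX ↦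
      forall_congr' fun hY ↦ forall_congr' fun hZ ↦ forall_congr' fun x ↦ ?_
    have e0 : (fun y ↦ (Real.exp (-τ y) • s y).comp (A y)) =
        fun y ↦ Real.exp (-τ y) • (s y).comp (A y) := rfl
    rw [e0, extDeriv2_smul hsA skA hX hY (hZ.diffVFieldAt x) (hg x),
      extDeriv2_smul h.smooth_s h.s_skew (h.smooth_A X hX) hY (hZ.diffVFieldAt x) (hg x),
      extDeriv2_smul h.smooth_s h.s_skew (h.smooth_A Y hY) hZ (hX.diffVFieldAt x) (hg x),
      extDeriv2_smul h.smooth_s h.s_skew (h.smooth_A Z hZ) hX (hY.diffVFieldAt x) (hg x), dg]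
    have e1 (U V W : VField E M) (w : Form2 E M) :
        wedgeForm12 (-(Real.exp (-τ x) • dFun τ x)) (w x) (U x) (V x) (W x) =
          -(Real.exp (-τ x) * wedgeForm12 (dFun τ x) (w x) (U x) (V x) (W x)) := by
      simp only [wedgeForm12, neg_apply, smul_apply, smul_eq_mul]
      ring
    rw [e1 X Y Z (fun y ↦ (s y).comp (A y)), e1 (fun y ↦ A y (X y)) Y Z s,
      e1 (fun y ↦ A y (Y y)) Z X s, e1 (fun y ↦ A y (Z y)) X Y s]
    -- In the cyclic sum `A` falls on one of the two arguments of `σ` twice and on that of `dτ`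
    -- once. One of the two copies of `dτ ∧ σ_A` cancels against the one from `dσ_A`.
    have w : wedgeForm12 (dFun τ x) (s x) (A x (X x)) (Y x) (Z x)
        + wedgeForm12 (dFun τ x) (s x) (A x (Y x)) (Z x) (X x)
        + wedgeForm12 (dFun τ x) (s x) (A x (Z x)) (X x) (Y x) =
        2 * wedgeForm12 (dFun τ x) ((s x).comp (A x)) (X x) (Y x) (Z x)
        + wedgeForm12 ((dFun τ x).comp (A x)) (s x) (X x) (Y x) (Z x) := by
      have q (U V : VField E M) : s x (U x) (A x (V x)) = s x (A x (U x)) (V x) :=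
        (h.s_A x _ _).symm
      simp only [wedgeForm12, ContinuousLinearMap.comp_apply]
      rw [q, q, q]
      ring
    constructor <;> intro H
    · refine mul_left_cancel₀ (Real.exp_pos (-τ x)).ne' ?_
      linear_combination H - Real.exp (-τ x) * w
    · linear_combination Real.exp (-τ x) * H + Real.exp (-τ x) * w

end Conformal

end GenComplex

end

open GenComplex
theorem proposition3p1 {m : ℕ} {M : Type*} [TopologicalSpace M]
    [ChartedSpace (EuclideanSpace ℝ (Fin m)) M] [IsManifold (𝓡 m) ∞ M]
    [T2Space M] [SecondCountableTopology M]
    (Φ : GenAlmostComplexStructure (EuclideanSpace ℝ (Fin m)) M) :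
    Φ.GloballyConformalIntegrable ↔
      ∃ (τ : M → ℝ) (ϖ : Form1 (EuclideanSpace ℝ (Fin m)) M),
        ContMDiff (𝓡 m) 𝓘(ℝ, ℝ) ∞ τ ∧ ϖ = dFun τ ∧
        -- `[π, π] = -2 (♯_π ϖ) ∧ π`
        (∀ α β γ : Form1 (EuclideanSpace ℝ (Fin m)) M,
          SmoothForm1 α → SmoothForm1 β → SmoothForm1 γ →
          ∀ x, schouten Φ.pi Φ.pi α β γ x
            = -2 * wedgeVecBivector (Φ.pi x (ϖ x)) (Φ.pi x) (α x) (β x) (γ x)) ∧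
        -- `R_{(π, A)}(α, X) = ϖ(X) A ♯_π α - ϖ(AX) ♯_π α`
        (∀ (α : Form1 (EuclideanSpace ℝ (Fin m)) M) (X : VField (EuclideanSpace ℝ (Fin m)) M),
          SmoothForm1 α → SmoothVField X →
          ∀ x, concomitant Φ.pi Φ.A α X x
            = ϖ x (X x) • Φ.A x (Φ.pi x (α x)) - ϖ x (Φ.A x (X x)) • Φ.pi x (α x)) ∧
        -- `N_A(X, Y) - ♯_π [i(X ∧ Y) dσ]`
        -- `= -σ(X, Y) ♯_π ϖ + ϖ(X) (Id + A²)(Y) - ϖ(Y) (Id + A²)(X)`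
        (∀ X Y : VField (EuclideanSpace ℝ (Fin m)) M, SmoothVField X → SmoothVField Y →
          ∀ x, nijenhuis Φ.A X Y x - Φ.pi x (contractExtDeriv2 Φ.sigma X Y x)
            = -(Φ.sigma x (X x) (Y x) • Φ.pi x (ϖ x))
              + ϖ x (X x) • (Y x + Φ.A x (Φ.A x (Y x)))
              - ϖ x (Y x) • (X x + Φ.A x (Φ.A x (X x)))) ∧
        -- `dσ_A(X, Y, Z) - Σ_cycl dσ(AX, Y, Z) = -[ϖ ∧ σ_A + (ϖ ∘ A) ∧ σ](X, Y, Z)`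
        (∀ X Y Z : VField (EuclideanSpace ℝ (Fin m)) M,
          SmoothVField X → SmoothVField Y → SmoothVField Z →
          ∀ x, extDeriv2 Φ.sigmaA X Y Z x
              - (extDeriv2 Φ.sigma (fun y ↦ Φ.A y (X y)) Y Z x
                + extDeriv2 Φ.sigma (fun y ↦ Φ.A y (Y y)) Z X x
                + extDeriv2 Φ.sigma (fun y ↦ Φ.A y (Z y)) X Y x)
            = -(wedgeForm12 (ϖ x) (Φ.sigmaA x) (X x) (Y x) (Z x)
                + wedgeForm12 ((ϖ x).comp (Φ.A x)) (Φ.sigma x) (X x) (Y x) (Z x))) := by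
  -- The equivalence holds for each `τ` separately.
  refine exists_congr fun τ ↦ ⟨fun ⟨hτ, H⟩ ↦ ⟨dFun τ, hτ, rfl, ?_⟩, ?_⟩
  · exact (Φ.hasComponents.isIntegrable_conformalChange_iff hτ).1 H
  · rintro ⟨_, hτ, rfl, H⟩
    exact ⟨hτ, (Φ.hasComponents.isIntegrable_conformalChange_iff hτ).2 H⟩
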